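/- Let $\alpha,\gamma$ be distinct positive numbers, let $K\subset\mathbb{R}^d$ be compact, and let $\lambda,\nu$ be two non-zero Radon (that is, finite Borel) measures on $K$. For a centered continuous Gaussian field $X$ on $K$ define $$ \mathcal{Q}_X=\frac{\left(\int_K e^{\alpha X(x)-\frac{\alpha^2}{2}\mathbb{E}[X(x)^2]}\,\lambda(dx)\right)^{\frac{\gamma}{\gamma-\alpha}}}{\left(\int_K e^{\gamma X(x)-\frac{\gamma^2}{2}\mathbb{E}[X(x)^2]}\,\nu(dx)\right)^{\frac{\alpha}{\gamma-\alpha}}}. $$ Let $X$ and $Y$ be two centered continuous Gaussian fields on $K$ (possibly defined on different probability spaces) such that the kernel $(x,y)\mapsto\mathbb{E}[Y(x)Y(y)]-\mathbb{E}[X(x)X(y)]$ is positive definite, in the sense that $\sum_{i,j}c_ic_j\big(\mathbb{E}[Y(x_i)Y(x_j)]-\mathbb{E}[X(x_i)X(x_j)]\big)\ge 0$ for all finitely many $x_i\in K$, $c_i\in\mathbb{R}$. Then $\mathcal{Q}_X$ and $\mathcal{Q}_Y$ are almost surely positive and, for every non-decreasing convex function $F\colon(0,\infty)\to\mathbb{R}$,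 the expectations below are well defined in $(-\infty,+\infty]$ and satisfy $$ \mathbb{E}[F(\mathcal{Q}_X)]\le\mathbb{E}[F(\mathcal{Q}_Y)]. $$ -/

import Mathlib

open MeasureTheory ProbabilityTheory
open scoped ENNReal

/-- A (centered) continuous Gaussian field `X` indexed by a topological space `T`, on the probability
space `(Ω, P)`: all finite-dimensional marginals are Gaussian (possibly degenerate), all variables
have mean zero, and almost every sample path is continuous. -/
structure IsContinuousGaussianField {T Ω : Type*} [TopologicalSpace T] [MeasurableSpace Ω]
    (X : T → Ω → ℝ) (P : Measure Ω) : Prop where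
  gaussian : IsGaussianProcess X P
  centered : ∀ x, ∫ ω, X x ω ∂P = 0
  continuous : ∀ᵐ ω ∂P, Continuous fun x => X x ω

/-- The covariance kernel `(x, y) ↦ E[X(x) X(y)]` of a centered field. -/
noncomputable def covKernel {T Ω : Type*} [MeasurableSpace Ω]
    (X : T → Ω → ℝ) (P : Measure Ω) (x y : T) : ℝ :=
  ∫ ω, X x ω * X y ω ∂P

/-- The total mass `∫ exp (β X(x) - β² / 2 * E[X(x)²]) dμ(x)`, a random variable. -/
noncomputable def chaosMass {T Ω : Type*} [MeasurableSpace T] [MeasurableSpace Ω]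
    (β : ℝ) (μ : Measure T) (X : T → Ω → ℝ) (P : Measure Ω) (ω : Ω) : ℝ :=
  ∫ x, Real.exp (β * X x ω - β ^ 2 / 2 * covKernel X P x x) ∂μ

/-- The balanced ratio of the exponentials of the field `X`, integrated against `lam` and `nu`. -/
noncomputable def balancedRatio {T Ω : Type*} [MeasurableSpace T] [MeasurableSpace Ω]
    (α γ : ℝ) (lam nu : Measure T) (X : T → Ω → ℝ) (P : Measure Ω) (ω : Ω) : ℝ :=
  chaosMass α lam X P ω ^ (γ / (γ - α)) / chaosMass γ nu X P ω ^ (α / (γ - α))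

/-- The real random variable `f` has a well-defined expectation in `(-∞, +∞]`: it is measurable (up
to a null set) and its negative part has finite expectation. -/
def HasExpectation {Ω : Type*} [MeasurableSpace Ω] (P : Measure Ω) (f : Ω → ℝ) : Prop :=
  AEMeasurable f P ∧ ∫⁻ ω, ENNReal.ofReal (-f ω) ∂P < ∞

/-- The expectation `E[f⁺] - E[f⁻]` as an extended real number. -/
noncomputable def extExpectation {Ω : Type*} [MeasurableSpace Ω] (P : Measure Ω) (f : Ω → ℝ) :
    EReal :=
  ((∫⁻ ω, ENNReal.ofReal (f ω) ∂P : ℝ≥0∞) : EReal)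
    - ((∫⁻ ω, ENNReal.ofReal (-f ω) ∂P : ℝ≥0∞) : EReal)

/-! Exchanging `α` with `γ` and `lam` with `nu` leaves the ratio unchanged, so let `α < γ` and `q =
α / (γ - α)`. The ratio is then `A ^ (1 + q) / B ^ q`, the perspective of `t ^ (1 + q)`: jointly
convex in the masses `(A, B)`, and still convex after composition with a non-decreasing convex `F`.
If `V = U + R` with `R` centered Gaussian and independent of `U`, the normalised exponentials of `R`
have mean one, so the masses of `U` are the conditional expectations of those of `V`, and Jensen's
inequality compares the two ratios (`lintegral_fieldRatio_le_of_indep`).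

This does not apply directly to `X` and `Y`: the difference of the covariances need not be the
covariance of a field with continuous paths. Instead, project `Y x` in `L²` on the span of `Y (s 0),
..., Y (s (n - 1))`, with `s` a dense sequence, and use the same coefficients `l n x` for both
fields: `Xₙ = ∑ l X(s j)` and `Yₙ = ∑ l Y(s j)`. Two applications of Jensen's inequality give `E
F(Q_{Xₙ}) ≤ E F(Q_{Yₙ}) ≤ E F(Q_Y)`. In the first, `Yₙ` has the law of `Xₙ` plus a field driven by
an independent Gaussian vector (`lintegral_fieldRatio_sum_mul_le`); in the second, `Yₙ` is a
conditional expectation of `Y` (`lintegral_fieldRatio_projection_le`).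

Positivity of the difference kernel bounds the `L²` error of `Xₙ` by that of `Yₙ`, which tends to
zero. Hence the masses of `Xₙ` converge in `L¹`, and Fatou's lemma gives the claim for `F ≥ 0`
(`lintegral_fieldRatio_le_of_tendsto`). A general `F` is bounded below on `(0, ∞)`, so adding a
constant suffices. -/

/-! ### Convexity of the balanced ratio and Jensen's inequality. -/

/-- The line through `(x, F x)` whose slope is the right derivative supports a convex function. -/
lemma ConvexOn.add_rightDeriv_mul_sub_le {F : ℝ → ℝ} (hF : ConvexOn ℝ (Set.Ioi 0) F) {x y : ℝ}
    (hx : 0 < x) (hy : 0 < y) :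
    F x + derivWithin F (Set.Ioi x) x * (y - x) ≤ F y := by
  have hx' : x ∈ interior (Set.Ioi (0 : ℝ)) := by simpa using hx
  rcases lt_trichotomy x y with h | rfl | h
  · have := hF.rightDeriv_le_slope_of_mem_interior hx' hy h
    rw [slope_def_field, le_div_iff₀ (by linarith)] at this
    linarith
  · simp
  · have h1 := hF.slope_le_leftDeriv_of_mem_interior hy hx' h
    have h2 := hF.leftDeriv_le_rightDeriv_of_mem_interior hx'
    have := h1.trans h2
    rw [slope_def_field, div_le_iff₀ (by linarith)] at this
    linarith

lemma MonotoneOn.rightDeriv_nonneg {F : ℝ → ℝ} (hF : MonotoneOn F (Set.Ioi 0)) {x : ℝ}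
    (hx : 0 < x) : 0 ≤ derivWithin F (Set.Ioi x) x :=
  (hF.mono (Set.Ioi_subset_Ioi hx.le)).derivWithin_nonneg

/-- The tangent plane inequality for the perspective `a ^ (1 + q) / b ^ q`. -/
lemma tangent_le_rpow_div_rpow {q a b r : ℝ} (hq : 0 < q) (ha : 0 < a) (hb : 0 < b) (hr : 0 < r) :
    (1 + q) * r ^ q * a - q * r ^ (1 + q) * b ≤ a ^ (1 + q) / b ^ q := by
  -- Bernoulli's inequality at `a / b = r (1 + s)`, to be multiplied by `b * r ^ (1 + q)`.
  have h := one_add_mul_self_le_rpow_one_add (s := a / b / r - 1) (p := 1 + q)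
    (by have : 0 < a / b / r := by positivity
        linarith) (by linarith)
  have e : a ^ (1 + q) / b ^ q = b * r ^ (1 + q) * (1 + (a / b / r - 1)) ^ (1 + q) := by
    rw [add_sub_cancel, Real.div_rpow (by positivity) hr.le, Real.div_rpow ha.le hb.le,
      Real.rpow_add hb, Real.rpow_one]
    field_simp
  rw [e]
  refine le_trans (le_of_eq ?_) (mul_le_mul_of_nonneg_left h (by positivity))
  rw [Real.rpow_add hr, Real.rpow_one]
  field_simp
  ring

/-- Equality case `r = a / b` of the tangent inequality: by homogeneity of degree one (Euler), the
tangent plane has no constant term. -/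
lemma rpow_div_rpow_eq {q a b : ℝ} (ha : 0 < a) (hb : 0 < b) :
    a ^ (1 + q) / b ^ q = (1 + q) * (a / b) ^ q * a - q * (a / b) ^ (1 + q) * b := by
  rw [Real.rpow_add (by positivity : 0 < a / b), Real.rpow_one, Real.rpow_add ha, Real.rpow_one,
    Real.div_rpow ha.le hb.le]
  field_simp
  ring

/-- A Jensen inequality for `F (a ^ (1 + q) / b ^ q)`, where `(A₀, B₀)` is the conditional
expectation of `(A, B)` given `m`. -/
lemma lintegral_comp_rpow_div_rpow_le {Ω : Type*} {m mΩ : MeasurableSpace Ω} {P : Measure Ω}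
    (hm : m ≤ mΩ) {q : ℝ} (hq : 0 < q) {A₀ B₀ A B : Ω → ℝ}
    (hA₀ : Measurable[m] A₀) (hB₀ : Measurable[m] B₀) (hA : Measurable A) (hB : Measurable B)
    (hA₀p : ∀ ω, 0 < A₀ ω) (hB₀p : ∀ ω, 0 < B₀ ω) (hAp : ∀ ω, 0 < A ω) (hBp : ∀ ω, 0 < B ω)
    [IsFiniteMeasure P]
    (hAA : ∀ f : Ω → ℝ≥0∞, Measurable[m] f →
      ∫⁻ ω, f ω * ENNReal.ofReal (A ω) ∂P = ∫⁻ ω, f ω * ENNReal.ofReal (A₀ ω) ∂P)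
    (hBB : ∀ f : Ω → ℝ≥0∞, Measurable[m] f →
      ∫⁻ ω, f ω * ENNReal.ofReal (B ω) ∂P = ∫⁻ ω, f ω * ENNReal.ofReal (B₀ ω) ∂P)
    {F : ℝ → ℝ} (hFm : MonotoneOn F (Set.Ioi 0)) (hFc : ConvexOn ℝ (Set.Ioi 0) F)
    (hF0 : ∀ x, 0 < x → 0 ≤ F x) :
    ∫⁻ ω, ENNReal.ofReal (F (A₀ ω ^ (1 + q) / B₀ ω ^ q)) ∂P ≤
      ∫⁻ ω, ENNReal.ofReal (F (A ω ^ (1 + q) / B ω ^ q)) ∂P := by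
  set Q₀ : Ω → ℝ := fun ω => A₀ ω ^ (1 + q) / B₀ ω ^ q with hQ₀
  have hQ₀m : Measurable[m] Q₀ := (hA₀.pow_const _).div (hB₀.pow_const _)
  have hQ₀p : ∀ ω, 0 < Q₀ ω := fun ω =>
    div_pos (Real.rpow_pos_of_pos (hA₀p ω) _) (Real.rpow_pos_of_pos (hB₀p ω) _)
  set g : Ω → ℝ := fun ω => derivWithin F (Set.Ioi (Q₀ ω)) (Q₀ ω) with hg
  have hgm : Measurable[m] g := (measurable_derivWithin_Ioi F).comp hQ₀m
  have hg0 : ∀ ω, 0 ≤ g ω := fun ω => hFm.rightDeriv_nonneg (hQ₀p ω)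
  -- `u` and `-w` are the partial derivatives of `(a, b) ↦ F (a ^ (1 + q) / b ^ q)` at `(A₀, B₀)`,
  -- with the right derivative of `F`.
  set u : Ω → ℝ := fun ω => g ω * ((1 + q) * (A₀ ω / B₀ ω) ^ q) with hu
  set w : Ω → ℝ := fun ω => g ω * (q * (A₀ ω / B₀ ω) ^ (1 + q)) with hw
  have hum : Measurable[m] u := hgm.mul (((hA₀.div hB₀).pow_const _).const_mul _)
  have hwm : Measurable[m] w := hgm.mul (((hA₀.div hB₀).pow_const _).const_mul _)
  have hr : ∀ ω, 0 < A₀ ω / B₀ ω := fun ω => div_pos (hA₀p ω) (hB₀p ω)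
  have hu0 : ∀ ω, 0 ≤ u ω := fun ω => by have := hg0 ω; have := hr ω; positivity
  have hw0 : ∀ ω, 0 ≤ w ω := fun ω => by have := hg0 ω; have := hr ω; positivity
  -- The tangent inequality with the negative terms moved across, so that every term is non-negative
  -- and `lintegral` applies without integrability of the ratio.
  have key : ∀ ω, F (Q₀ ω) + u ω * A ω + w ω * B₀ ω ≤
      F (A ω ^ (1 + q) / B ω ^ q) + w ω * B ω + u ω * A₀ ω := by
    intro ω
    have h1 := tangent_le_rpow_div_rpow hq (hAp ω) (hBp ω) (hr ω)
    have h2 := hFc.add_rightDeriv_mul_sub_le (hQ₀p ω) (y := A ω ^ (1 + q) / B ω ^ q)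
      (div_pos (Real.rpow_pos_of_pos (hAp ω) _) (Real.rpow_pos_of_pos (hBp ω) _))
    have h3 : Q₀ ω = _ := rpow_div_rpow_eq (hA₀p ω) (hB₀p ω)
    have h4 := mul_le_mul_of_nonneg_left h1 (hg0 ω)
    have h5 : g ω * Q₀ ω = u ω * A₀ ω - w ω * B₀ ω := by rw [h3]; simp only [hu, hw]; ring
    have h6 : g ω * ((1 + q) * (A₀ ω / B₀ ω) ^ q * A ω - q * (A₀ ω / B₀ ω) ^ (1 + q) * B ω)
      = u ω * A ω - w ω * B ω := by simp only [hu, hw]; ring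
    rw [h6] at h4
    change F (Q₀ ω) + g ω * _ ≤ _ at h2
    linarith
  -- Localisation to `m`-measurable sets on which `u * A₀` and `w * B₀` are bounded, so that the
  -- linear terms have finite integrals and cancel.
  set s : ℕ → Set Ω := fun N => {ω | u ω ≤ N ∧ w ω ≤ N ∧ A₀ ω ≤ N ∧ B₀ ω ≤ N} with hs
  have hsm : ∀ N, MeasurableSet[m] (s N) := fun N =>
    (measurableSet_le hum measurable_const).inter <| (measurableSet_le hwm measurable_const).inter <|
      (measurableSet_le hA₀ measurable_const).inter (measurableSet_le hB₀ measurable_const)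
  have hmono : Monotone s := by
    intro i j hij ω h
    have : (i : ℝ) ≤ j := by exact_mod_cast hij
    exact ⟨h.1.trans this, h.2.1.trans this, h.2.2.1.trans this, h.2.2.2.trans this⟩
  have hsU : ⋃ N, s N = Set.univ := by
    refine Set.eq_univ_of_forall fun ω => Set.mem_iUnion.2 ?_
    obtain ⟨N, hN⟩ := exists_nat_ge (max (max (u ω) (w ω)) (max (A₀ ω) (B₀ ω)))
    simp only [max_le_iff] at hN
    exact ⟨N, hN.1.1, hN.1.2, hN.2.1, hN.2.2⟩
  have hstep : ∀ N, ∫⁻ ω in s N, ENNReal.ofReal (F (Q₀ ω)) ∂P ≤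
      ∫⁻ ω, ENNReal.ofReal (F (A ω ^ (1 + q) / B ω ^ q)) ∂P := by
    intro N
    have htrans : ∀ {v C C₀ : Ω → ℝ}, Measurable[m] v → (∀ ω, 0 ≤ v ω) →
        (∀ f : Ω → ℝ≥0∞, Measurable[m] f →
          ∫⁻ ω, f ω * ENNReal.ofReal (C ω) ∂P = ∫⁻ ω, f ω * ENNReal.ofReal (C₀ ω) ∂P) →
        ∫⁻ ω in s N, ENNReal.ofReal (v ω * C ω) ∂P =
          ∫⁻ ω in s N, ENNReal.ofReal (v ω * C₀ ω) ∂P := by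
      intro v C C₀ hv hv0 h
      have := h ((s N).indicator fun ω => ENNReal.ofReal (v ω))
        ((hv.ennreal_ofReal).indicator (hsm N))
      rw [← lintegral_indicator (hm _ (hsm N)), ← lintegral_indicator (hm _ (hsm N))]
      convert this using 2 <;> ext ω <;> by_cases hω : ω ∈ s N <;>
        simp [hω, ENNReal.ofReal_mul (hv0 ω)]
    have hfin : ∀ {v C₀ : Ω → ℝ}, (∀ ω, 0 ≤ v ω) → (∀ ω ∈ s N, v ω ≤ N) →
        (∀ ω ∈ s N, C₀ ω ≤ N) → ∫⁻ ω in s N, ENNReal.ofReal (v ω * C₀ ω) ∂P ≠ ∞ := by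
      intro v C₀ hv0 hv hC
      refine ne_of_lt (lt_of_le_of_lt (setLIntegral_mono' (g := fun _ => ENNReal.ofReal (N * N))
        (hm _ (hsm N)) fun ω hω => ENNReal.ofReal_le_ofReal ?_) ?_)
      · exact (mul_le_mul_of_nonneg_left (hC ω hω) (hv0 ω)).trans
          (mul_le_mul_of_nonneg_right (hv ω hω) (by positivity))
      · simp [ENNReal.mul_lt_top_iff]
    have hAe := htrans hum hu0 hAA
    have hBe := htrans hwm hw0 hBB
    have hAf := hfin hu0 (C₀ := A₀) (fun ω h => h.1) (fun ω h => h.2.2.1)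
    have hBf := hfin hw0 (C₀ := B₀) (fun ω h => h.2.1) (fun ω h => h.2.2.2)
    have mA₀ : Measurable A₀ := hA₀.mono hm le_rfl
    have mB₀ : Measurable B₀ := hB₀.mono hm le_rfl
    have mu : Measurable u := hum.mono hm le_rfl
    have mw : Measurable w := hwm.mono hm le_rfl
    have hint : ∫⁻ ω in s N, (ENNReal.ofReal (F (Q₀ ω)) + ENNReal.ofReal (u ω * A ω)
        + ENNReal.ofReal (w ω * B₀ ω)) ∂P ≤
        ∫⁻ ω in s N, (ENNReal.ofReal (F (A ω ^ (1 + q) / B ω ^ q)) + ENNReal.ofReal (w ω * B ω)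
        + ENNReal.ofReal (u ω * A₀ ω)) ∂P := by
      refine lintegral_mono fun ω => ?_
      have h1 := hF0 _ (hQ₀p ω)
      have h2 := hF0 (A ω ^ (1 + q) / B ω ^ q)
        (div_pos (Real.rpow_pos_of_pos (hAp ω) _) (Real.rpow_pos_of_pos (hBp ω) _))
      have h3 := mul_nonneg (hu0 ω) (hAp ω).le
      have h4 := mul_nonneg (hu0 ω) (hA₀p ω).le
      have h5 := mul_nonneg (hw0 ω) (hBp ω).le
      have h6 := mul_nonneg (hw0 ω) (hB₀p ω).le
      dsimp only
      rw [← ENNReal.ofReal_add h1 h3, ← ENNReal.ofReal_add (by positivity) h6,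
        ← ENNReal.ofReal_add h2 h5, ← ENNReal.ofReal_add (by positivity) h4]
      exact ENNReal.ofReal_le_ofReal (key ω)
    rw [lintegral_add_right _ (by fun_prop), lintegral_add_right _ (by fun_prop),
      lintegral_add_right _ (by fun_prop), lintegral_add_right _ (by fun_prop), hAe, hBe,
      add_right_comm, ENNReal.add_le_add_iff_right hAf, ENNReal.add_le_add_iff_right hBf] at hint
    exact hint.trans (setLIntegral_le_lintegral _ _)
  rw [← setLIntegral_univ (fun ω => ENNReal.ofReal (F (Q₀ ω))), ← hsU,
    setLIntegral_iUnion_of_directed _ hmono.directed_le]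
  exact iSup_le hstep

/-! ### Masses of continuous paths and the effect of an independent Gaussian increment. -/

/-- The mass `∫ exp (β U(x) - β² / 2 * u(x)) dμ(x)` of a path `U` with variance function `u`. -/
noncomputable def fieldMass {T : Type*} [MeasurableSpace T] (β : ℝ) (μ : Measure T)
    (u U : T → ℝ) : ℝ :=
  ∫ x, Real.exp (β * U x - β ^ 2 / 2 * u x) ∂μ

/-- The balanced ratio of a path `U` with variance function `u`. -/
noncomputable def fieldRatio {T : Type*} [MeasurableSpace T] (α γ : ℝ) (lam nu : Measure T)
    (u U : T → ℝ) : ℝ :=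
  fieldMass α lam u U ^ (γ / (γ - α)) / fieldMass γ nu u U ^ (α / (γ - α))

lemma fieldRatio_eq {T : Type*} [MeasurableSpace T] {lam nu : Measure T} {α γ : ℝ} (h : α < γ) (u U : T → ℝ) :
    fieldRatio α γ lam nu u U =
      fieldMass α lam u U ^ (1 + α / (γ - α)) / fieldMass γ nu u U ^ (α / (γ - α)) := by
  rw [fieldRatio, show γ / (γ - α) = 1 + α / (γ - α) by
    have : γ - α ≠ 0 := by linarith
    field_simp; ring]

lemma fieldRatio_swap {T : Type*} [MeasurableSpace T] {lam nu : Measure T} (α γ : ℝ) (u U : T → ℝ) :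
    fieldRatio α γ lam nu u U = fieldRatio γ α nu lam u U := by
  have h : ∀ β (μ : Measure T), 0 ≤ fieldMass β μ u U := fun β μ =>
    integral_nonneg fun _ => (Real.exp_pos _).le
  rw [fieldRatio, fieldRatio, ← neg_sub γ α, div_neg, div_neg, Real.rpow_neg (h _ _),
    Real.rpow_neg (h _ _), div_inv_eq_mul, div_eq_mul_inv, mul_comm]

section FieldMass

variable {T : Type*} [MetricSpace T] [CompactSpace T] [MeasurableSpace T] [BorelSpace T]
  {μ lam nu : Measure T} [IsFiniteMeasure μ] [IsFiniteMeasure lam] [IsFiniteMeasure nu]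

lemma integrable_exp_field (β : ℝ) {u U : T → ℝ} (hu : Continuous u) (hU : Continuous U) :
    Integrable (fun x => Real.exp (β * U x - β ^ 2 / 2 * u x)) μ :=
  (by fun_prop : Continuous fun x => Real.exp (β * U x - β ^ 2 / 2 * u x)).integrable_of_hasCompactSupport
    (HasCompactSupport.of_compactSpace _)

lemma ofReal_fieldMass (β : ℝ) {u U : T → ℝ} (hu : Continuous u) (hU : Continuous U) :
    ENNReal.ofReal (fieldMass β μ u U) =
      ∫⁻ x, ENNReal.ofReal (Real.exp (β * U x - β ^ 2 / 2 * u x)) ∂μ :=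
  ofReal_integral_eq_lintegral_ofReal (integrable_exp_field β hu hU)
    (.of_forall fun _ => (Real.exp_pos _).le)

lemma fieldMass_pos (β : ℝ) (hμ : μ ≠ 0) {u U : T → ℝ} (hu : Continuous u) (hU : Continuous U) :
    0 < fieldMass β μ u U := by
  have : NeZero μ := ⟨hμ⟩
  exact integral_exp_pos (integrable_exp_field β hu hU)

lemma fieldRatio_pos (α γ : ℝ) (hlam : lam ≠ 0) (hnu : nu ≠ 0) {u U : T → ℝ}
    (hu : Continuous u) (hU : Continuous U) : 0 < fieldRatio α γ lam nu u U :=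
  div_pos (Real.rpow_pos_of_pos (fieldMass_pos α hlam hu hU) _)
    (Real.rpow_pos_of_pos (fieldMass_pos γ hnu hu hU) _)

lemma measurable_exp_field {Ω : Type*} {m : MeasurableSpace Ω} (β : ℝ) {u : T → ℝ}
    {U : T → Ω → ℝ} (hu : Continuous u) (hUc : ∀ ω, Continuous fun x => U x ω)
    (hUm : ∀ x, Measurable[m] (U x)) :
    Measurable fun p : T × Ω => Real.exp (β * U p.1 p.2 - β ^ 2 / 2 * u p.1) :=
  measurable_uncurry_of_continuous_of_measurable
    (u := fun x ω => Real.exp (β * U x ω - β ^ 2 / 2 * u x))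
    (fun ω => by have := hUc ω; fun_prop) (fun x => by have := hUm x; fun_prop)

lemma measurable_fieldMass {Ω : Type*} {m : MeasurableSpace Ω} (β : ℝ) {u : T → ℝ}
    {U : T → Ω → ℝ} (hu : Continuous u) (hUc : ∀ ω, Continuous fun x => U x ω)
    (hUm : ∀ x, Measurable[m] (U x)) :
    Measurable[m] fun ω => fieldMass β μ u fun x => U x ω :=
  ((measurable_exp_field β hu hUc hUm).stronglyMeasurable.integral_prod_left'
    (μ := μ)).measurable

lemma measurable_fieldRatio {Ω : Type*} {m : MeasurableSpace Ω} (α γ : ℝ) {u : T → ℝ}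
    {U : T → Ω → ℝ} (hu : Continuous u) (hUc : ∀ ω, Continuous fun x => U x ω)
    (hUm : ∀ x, Measurable[m] (U x)) :
    Measurable[m] fun ω => fieldRatio α γ lam nu u fun x => U x ω :=
  ((measurable_fieldMass α hu hUc hUm).pow_const _).div
    ((measurable_fieldMass γ hu hUc hUm).pow_const _)

/-- The exponential martingale has mean one. -/
lemma integrable_exp_gaussian {Ω : Type*} [MeasurableSpace Ω] {P : Measure Ω} {Z : Ω → ℝ}
    (hZ : HasGaussianLaw Z P) (hc : ∫ ω, Z ω ∂P = 0) (β : ℝ) :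
    Integrable (fun ω => Real.exp (β * Z ω - β ^ 2 / 2 * ∫ ω', Z ω' ^ 2 ∂P)) P ∧
      ∫ ω, Real.exp (β * Z ω - β ^ 2 / 2 * ∫ ω', Z ω' ^ 2 ∂P) ∂P = 1 := by
  have hv : Var[Z; P] = ∫ ω, Z ω ^ 2 ∂P := variance_of_integral_eq_zero hZ.aemeasurable hc
  have hP := hZ.isProbabilityMeasure
  have hmap := hZ.map_eq_gaussianReal
  rw [hc] at hmap
  have hint : Integrable (fun ω => Real.exp (β * Z ω)) P := by
    have := integrable_exp_mul_gaussianReal (μ := 0) (v := Var[Z; P].toNNReal) β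
    rw [← hmap] at this
    exact this.comp_aemeasurable hZ.aemeasurable
  simp_rw [Real.exp_sub]
  refine ⟨hint.div_const _, ?_⟩
  rw [integral_div]
  change mgf Z P β / _ = 1
  rw [mgf_gaussianReal hmap β, ← Real.exp_sub, Real.coe_toNNReal _ (variance_nonneg _ _), hv]
  ring_nf
  simp

lemma lintegral_exp_gaussian {Ω : Type*} [MeasurableSpace Ω] {P : Measure Ω} {Z : Ω → ℝ}
    (hZ : HasGaussianLaw Z P) (hc : ∫ ω, Z ω ∂P = 0) (β : ℝ) :
    ∫⁻ ω, ENNReal.ofReal (Real.exp (β * Z ω - β ^ 2 / 2 * ∫ ω', Z ω' ^ 2 ∂P)) ∂P = 1 := by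
  rw [← ofReal_integral_eq_lintegral_ofReal (integrable_exp_gaussian hZ hc β).1
    (.of_forall fun _ => (Real.exp_pos _).le), (integrable_exp_gaussian hZ hc β).2,
    ENNReal.ofReal_one]

/-- Adding to a field an independent centered Gaussian one increases the expectation of a
non-decreasing convex function of the balanced ratio. -/
lemma lintegral_fieldRatio_le_of_indep {Ω : Type*} {m mΩ : MeasurableSpace Ω} {P : Measure Ω}
    [IsProbabilityMeasure P] (hm : m ≤ mΩ) {α γ : ℝ} (hα : 0 < α) (hαγ : α < γ)
    (hlam : lam ≠ 0) (hnu : nu ≠ 0) {u v : T → ℝ} {U V : T → Ω → ℝ}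
    (hu : Continuous u) (hv : Continuous v)
    (hUc : ∀ ω, Continuous fun x => U x ω) (hVc : ∀ ω, Continuous fun x => V x ω)
    (hUm : ∀ x, Measurable[m] (U x)) (hVm : ∀ x, Measurable (V x))
    (hind : ∀ x, Indep m (MeasurableSpace.comap (fun ω => V x ω - U x ω) inferInstance) P)
    (hR : ∀ x, HasGaussianLaw (fun ω => V x ω - U x ω) P)
    (hRc : ∀ x, ∫ ω, (V x ω - U x ω) ∂P = 0)
    (huv : ∀ x, v x = u x + ∫ ω, (V x ω - U x ω) ^ 2 ∂P)
    {F : ℝ → ℝ} (hFm : MonotoneOn F (Set.Ioi 0)) (hFc : ConvexOn ℝ (Set.Ioi 0) F)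
    (hF0 : ∀ x, 0 < x → 0 ≤ F x) :
    ∫⁻ ω, ENNReal.ofReal (F (fieldRatio α γ lam nu u fun x => U x ω)) ∂P ≤
      ∫⁻ ω, ENNReal.ofReal (F (fieldRatio α γ lam nu v fun x => V x ω)) ∂P := by
  have hUm' : ∀ x, Measurable (U x) := fun x => (hUm x).mono hm le_rfl
  -- The conditional expectation of the mass of `V` given `m` is the mass of `U`. After Tonelli, the
  -- exponential of `V` factors into that of `U` times that of the independent `V - U`, which has
  -- mean one.
  have cond : ∀ (β : ℝ) (μ : Measure T) [IsFiniteMeasure μ] (f : Ω → ℝ≥0∞), Measurable[m] f →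
      ∫⁻ ω, f ω * ENNReal.ofReal (fieldMass β μ v fun x => V x ω) ∂P =
        ∫⁻ ω, f ω * ENNReal.ofReal (fieldMass β μ u fun x => U x ω) ∂P := by
    intro β μ _ f hf
    have hf' : Measurable f := hf.mono hm le_rfl
    have swap : ∀ {w : T → ℝ} {W : T → Ω → ℝ}, Continuous w → (∀ ω, Continuous fun x => W x ω) →
        (∀ x, Measurable (W x)) →
        ∫⁻ ω, f ω * ENNReal.ofReal (fieldMass β μ w fun x => W x ω) ∂P =
          ∫⁻ x, ∫⁻ ω, f ω * ENNReal.ofReal (Real.exp (β * W x ω - β ^ 2 / 2 * w x)) ∂P ∂μ := by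
      intro w W hw hWc hWm
      have hj := measurable_exp_field β hw hWc hWm
      rw [lintegral_lintegral_swap]
      · refine lintegral_congr fun ω => ?_
        rw [ofReal_fieldMass β hw (hWc ω), lintegral_const_mul]
        exact (hj.comp (measurable_id.prodMk measurable_const)).ennreal_ofReal
      · exact ((hf'.comp measurable_snd).mul hj.ennreal_ofReal).aemeasurable
    rw [swap hv hVc hVm, swap hu hUc hUm']
    refine lintegral_congr fun x => ?_
    have hU1 := hUm x
    have e : ∀ ω, f ω * ENNReal.ofReal (Real.exp (β * V x ω - β ^ 2 / 2 * v x)) =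
        (f ω * ENNReal.ofReal (Real.exp (β * U x ω - β ^ 2 / 2 * u x))) *
        ENNReal.ofReal (Real.exp (β * (V x ω - U x ω) -
          β ^ 2 / 2 * ∫ ω, (V x ω - U x ω) ^ 2 ∂P)) := by
      intro ω
      rw [mul_assoc, ← ENNReal.ofReal_mul (Real.exp_pos _).le, ← Real.exp_add, huv x]
      ring_nf
    simp_rw [e]
    rw [lintegral_mul_eq_lintegral_mul_lintegral_of_independent_measurableSpace hm
      ((hVm x).sub (hUm' x)).comap_le (hind x), lintegral_exp_gaussian (hR x) (hRc x), mul_one]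
    · exact hf.mul (((hU1.const_mul _).sub_const _).exp.ennreal_ofReal)
    · exact (((comap_measurable (fun ω => V x ω - U x ω)).const_mul β).sub_const
        _).exp.ennreal_ofReal
  simp_rw [fieldRatio_eq hαγ]
  exact lintegral_comp_rpow_div_rpow_le hm (div_pos hα (sub_pos.2 hαγ))
    (measurable_fieldMass α hu hUc hUm) (measurable_fieldMass γ hu hUc hUm)
    (measurable_fieldMass α hv hVc hVm) (measurable_fieldMass γ hv hVc hVm)
    (fun ω => fieldMass_pos α hlam hu (hUc ω)) (fun ω => fieldMass_pos γ hnu hu (hUc ω))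
    (fun ω => fieldMass_pos α hlam hv (hVc ω)) (fun ω => fieldMass_pos γ hnu hv (hVc ω))
    (cond α lam) (cond γ nu) hFm hFc hF0

end FieldMass

/-! ### Regular versions of continuous Gaussian fields. -/

/-- A centered Gaussian field, all of whose variables are measurable and all of whose sample paths
are continuous. -/
structure IsRegularGaussianField {T Ω : Type*} [TopologicalSpace T] [MeasurableSpace Ω]
    (X : T → Ω → ℝ) (P : Measure Ω) : Prop where
  gaussian : IsGaussianProcess X P
  centered : ∀ x, ∫ ω, X x ω ∂P = 0
  measurable : ∀ x, Measurable (X x)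
  continuous : ∀ ω, Continuous fun x => X x ω

/-- The field is set to zero off a measurable set of full measure where paths are continuous and
agree with measurable versions on a countable dense set. Measurability at other points follows by
taking limits. A single null set serves all `x`. -/
lemma IsContinuousGaussianField.exists_regular {T Ω : Type*} [MetricSpace T] [CompactSpace T]
    [MeasurableSpace Ω] {X : T → Ω → ℝ} {P : Measure Ω} (hX : IsContinuousGaussianField X P) :
    ∃ X' : T → Ω → ℝ, IsRegularGaussianField X' P ∧ ∀ᵐ ω ∂P, ∀ x, X x ω = X' x ω := by
  obtain ⟨D, hDc, hDd⟩ := TopologicalSpace.exists_countable_dense T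
  have : Countable D := hDc
  have hm : ∀ᵐ ω ∂P, ∀ z : D, X z ω = (hX.gaussian.aemeasurable z).mk _ ω :=
    ae_all_iff.2 fun z => (hX.gaussian.aemeasurable z).ae_eq_mk
  obtain ⟨s, hs, hsm, hsP⟩ := (hX.continuous.and hm).exists_measurable_mem
  have hae : ∀ᵐ ω ∂P, ∀ x, X x ω = s.indicator (X x) ω := by
    filter_upwards [hs] with ω hω x
    simp [hω]
  refine ⟨fun x => s.indicator (X x), ⟨hX.gaussian.congr fun x => ?_, fun x => ?_, fun x => ?_,
    fun ω => ?_⟩, hae⟩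
  · filter_upwards [hae] with ω h using h x
  · rw [← hX.centered x]
    refine integral_congr_ae ?_
    filter_upwards [hae] with ω h using (h x).symm
  · obtain ⟨z, hzD, hz⟩ := mem_closure_iff_seq_limit.1 (hDd x)
    refine measurable_of_tendsto_metrizable
      (f := fun n => s.indicator ((hX.gaussian.aemeasurable (z n)).mk _))
      (fun n => (hX.gaussian.aemeasurable (z n)).measurable_mk.indicator hsm) ?_
    refine tendsto_pi_nhds.2 fun ω => ?_
    by_cases hω : ω ∈ s
    · simp only [Set.indicator_of_mem hω]
      have h1 := ((hsP ω hω).1.tendsto x).comp hz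
      refine h1.congr fun n => (hsP ω hω).2 ⟨z n, hzD n⟩
    · simp [hω]
  · by_cases hω : ω ∈ s
    · simpa only [Set.indicator_of_mem hω] using (hsP ω hω).1
    · simp only [Set.indicator_of_notMem hω]
      exact continuous_const

/-! ### Orthogonal projection with continuous coefficients. -/

section Hilbert

open scoped RealInnerProductSpace

variable {H : Type*} [NormedAddCommGroup H] [InnerProductSpace ℝ H]

/-- The coefficients of the orthogonal projection on a finite-dimensional span can be chosen
continuously. -/
lemma exists_continuous_projection_coeff {T : Type*} [TopologicalSpace T] {y : T → H}
    (hy : Continuous y) {n : ℕ} (s : Fin n → T) :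
    ∃ l : T → Fin n → ℝ, Continuous l ∧
      (∀ x i, ⟪y (s i), y x - ∑ j, l x j • y (s j)⟫ = 0) ∧
      ∀ x i, ‖y x - ∑ j, l x j • y (s j)‖ ≤ ‖y x - y (s i)‖ := by
  let c : (Fin n → ℝ) →ₗ[ℝ] H := Fintype.linearCombination ℝ fun i => y (s i)
  let V := LinearMap.range c
  -- The vectors `y (s i)` may be linearly dependent, so coefficients are not unique. A linear
  -- section of the combination map selects them, and it is continuous because its domain is
  -- finite-dimensional.
  obtain ⟨g, hg⟩ := c.rangeRestrict.exists_rightInverse_of_surjective c.range_rangeRestrict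
  have hV : ∀ v : V, ∑ j, g v j • y (s j) = v := fun v =>
    congrArg Subtype.val (LinearMap.congr_fun hg v)
  have hmem : ∀ i, y (s i) ∈ V := fun i => ⟨Pi.single i 1, by
    simp [c, Fintype.linearCombination_apply]⟩
  have hgc : Continuous g := LinearMap.continuous_of_finiteDimensional g
  refine ⟨fun x => g (V.orthogonalProjectionOnto (y x)), ?_, fun x i => ?_, fun x i => ?_⟩
  · exact hgc.comp (V.orthogonalProjectionOnto.continuous.comp hy)
  · rw [hV]
    rw [real_inner_comm, ← V.starProjection_apply]
    exact V.starProjection_inner_eq_zero _ _ (hmem i)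
  · rw [hV]
    rw [← V.starProjection_apply, V.starProjection_minimal]
    exact ciInf_le ⟨0, by rintro _ ⟨v, rfl⟩; exact norm_nonneg _⟩ (⟨y (s i), hmem i⟩ : V)

end Hilbert

/-! ### Geometry of a Gaussian process in `L²`. -/

section GaussianProcess

open scoped RealInnerProductSpace

variable {T Ω : Type*} {mΩ : MeasurableSpace Ω} {X : T → Ω → ℝ} {P : Measure Ω}

/-- A Gaussian process as a family of elements of `L²`. -/
noncomputable def ProbabilityTheory.IsGaussianProcess.toL2 (hX : IsGaussianProcess X P) (x : T) :
    Lp ℝ 2 P :=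
  (hX.hasGaussianLaw_eval x).memLp_two.toLp

lemma ProbabilityTheory.IsGaussianProcess.inner_toL2 (hX : IsGaussianProcess X P) (x z : T) :
    ⟪hX.toL2 x, hX.toL2 z⟫ = covKernel X P x z := by
  rw [L2.inner_def, covKernel]
  refine integral_congr_ae ?_
  filter_upwards [(hX.hasGaussianLaw_eval x).memLp_two.coeFn_toLp,
    (hX.hasGaussianLaw_eval z).memLp_two.coeFn_toLp] with ω h1 h2
  simp only [IsGaussianProcess.toL2, h1, h2, RCLike.inner_apply, conj_trivial]
  ring

lemma ProbabilityTheory.IsGaussianProcess.norm_toL2_sq (hX : IsGaussianProcess X P) (x : T) :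
    ‖hX.toL2 x‖ ^ 2 = covKernel X P x x := by
  rw [← hX.inner_toL2, real_inner_self_eq_norm_sq]

lemma integral_sq_eq_norm_toLp_sq {f : Ω → ℝ} (hf : MemLp f 2 P) :
    ∫ ω, f ω ^ 2 ∂P = ‖hf.toLp‖ ^ 2 := by
  rw [← real_inner_self_eq_norm_sq, L2.inner_def]
  refine integral_congr_ae ?_
  filter_upwards [hf.coeFn_toLp] with ω h
  simp only [h, RCLike.inner_apply, conj_trivial]
  ring

lemma ProbabilityTheory.IsGaussianProcess.hasGaussianLaw_pi {ι : Type*} [Fintype ι]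
    (hX : IsGaussianProcess X P) (s : ι → T) : HasGaussianLaw (fun ω i => X (s i) ω) P :=
  ((hX.comp_right s).hasGaussianLaw Finset.univ).map
    (ContinuousLinearMap.pi fun i =>
      ContinuousLinearMap.proj (R := ℝ) (φ := fun _ : (Finset.univ : Finset ι) => ℝ)
        ⟨i, Finset.mem_univ i⟩)

lemma ProbabilityTheory.IsGaussianProcess.hasGaussianLaw_sum_mul {ι : Type*} [Fintype ι]
    (hX : IsGaussianProcess X P) (s : ι → T) (l : ι → ℝ) :
    HasGaussianLaw (fun ω => ∑ j, l j * X (s j) ω) P := by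
  have := (hX.hasGaussianLaw_pi s).map_fun
    (LinearMap.toContinuousLinearMap (Fintype.linearCombination ℝ l))
  simpa [Fintype.linearCombination_apply, mul_comm] using this

lemma ProbabilityTheory.IsGaussianProcess.toLp_sum_mul {ι : Type*} [Fintype ι]
    (hX : IsGaussianProcess X P) (s : ι → T) (l : ι → ℝ) :
    (hX.hasGaussianLaw_sum_mul s l).memLp_two.toLp = ∑ j, l j • hX.toL2 (s j) := by
  refine Lp.ext ?_
  have h : ∀ᵐ ω ∂P, ∀ j, hX.toL2 (s j) ω = X (s j) ω := ae_all_iff.2 fun j =>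
    (hX.hasGaussianLaw_eval (s j)).memLp_two.coeFn_toLp
  have h2 : ∀ᵐ ω ∂P, ∀ j, (l j • hX.toL2 (s j) : Lp ℝ 2 P) ω = l j * hX.toL2 (s j) ω :=
    ae_all_iff.2 fun j => Lp.coeFn_smul _ _
  filter_upwards [(hX.hasGaussianLaw_sum_mul s l).memLp_two.coeFn_toLp, h, h2,
    Lp.coeFn_finsetSum Finset.univ fun j => l j • hX.toL2 (s j)] with ω h1 h2 h3 h4
  rw [h1, h4]
  simp [h2, h3]

lemma ProbabilityTheory.IsGaussianProcess.hasGaussianLaw_sub_sum_mul {ι : Type*} [Fintype ι]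
    (hX : IsGaussianProcess X P) (x : T) (s : ι → T) (l : ι → ℝ) :
    HasGaussianLaw (fun ω => X x ω - ∑ j, l j * X (s j) ω) P := by
  -- The residual is a linear combination indexed by `Option ι`, where `none` carries `x` with
  -- coefficient `1`.
  have := hX.hasGaussianLaw_sum_mul (fun o : Option ι => o.elim x s) (fun o => o.elim 1 (-l))
  simpa [Fintype.sum_option, sub_eq_add_neg] using this

lemma ProbabilityTheory.IsGaussianProcess.toLp_sub_sum_mul {ι : Type*} [Fintype ι]
    (hX : IsGaussianProcess X P) (x : T) (s : ι → T) (l : ι → ℝ) :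
    (hX.hasGaussianLaw_sub_sum_mul x s l).memLp_two.toLp =
      hX.toL2 x - ∑ j, l j • hX.toL2 (s j) := by
  rw [← hX.toLp_sum_mul, IsGaussianProcess.toL2, ← MemLp.toLp_sub]
  rfl

lemma ProbabilityTheory.IsGaussianProcess.integral_sum_mul {ι : Type*} [Fintype ι]
    (hX : IsGaussianProcess X P) (hc : ∀ x, ∫ ω, X x ω ∂P = 0) (s : ι → T) (l : ι → ℝ) :
    ∫ ω, ∑ j, l j * X (s j) ω ∂P = 0 := by
  rw [integral_finsetSum _ fun j _ => (hX.hasGaussianLaw_eval _).integrable.const_mul _]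
  simp [integral_const_mul, hc]

/-- The mean square of a linear combination of the variables of a centered Gaussian process. -/
lemma ProbabilityTheory.IsGaussianProcess.integral_sum_mul_sq {ι : Type*} [Fintype ι]
    (hX : IsGaussianProcess X P) (s : ι → T) (l : ι → ℝ) :
    ∫ ω, (∑ j, l j * X (s j) ω) ^ 2 ∂P =
      ∑ i, ∑ j, l i * l j * covKernel X P (s i) (s j) := by
  rw [integral_sq_eq_norm_toLp_sq (hX.hasGaussianLaw_sum_mul s l).memLp_two, hX.toLp_sum_mul,
    ← real_inner_self_eq_norm_sq, sum_inner]
  refine Finset.sum_congr rfl fun i _ => ?_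
  rw [inner_sum]
  refine Finset.sum_congr rfl fun j _ => ?_
  rw [real_inner_smul_left, real_inner_smul_right, hX.inner_toL2, mul_assoc]

/-- A centered Gaussian field with continuous paths is continuous in mean square. -/
lemma IsRegularGaussianField.continuous_toL2 {T : Type*} [MetricSpace T] {X : T → Ω → ℝ}
    (hX : IsRegularGaussianField X P) : Continuous hX.gaussian.toL2 := by
  have := hX.gaussian.isProbabilityMeasure
  refine continuous_iff_seqContinuous.2 fun z x hz => ?_
  set D : ℕ → Ω → ℝ := fun n ω => X (z n) ω - X x ω with hD
  have hDg : ∀ n, HasGaussianLaw (D n) P := fun n => hX.gaussian.hasGaussianLaw_fun_sub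
  have hDc : ∀ n, ∫ ω, D n ω ∂P = 0 := fun n => by
    rw [integral_sub (hX.gaussian.hasGaussianLaw_eval _).integrable
      (hX.gaussian.hasGaussianLaw_eval _).integrable, hX.centered, hX.centered, sub_zero]
  have hnorm : ∀ n, Var[D n; P] = ‖hX.gaussian.toL2 (z n) - hX.gaussian.toL2 x‖ ^ 2 := fun n => by
    rw [variance_of_integral_eq_zero (hDg n).aemeasurable (hDc n),
      integral_sq_eq_norm_toLp_sq (hDg n).memLp_two, IsGaussianProcess.toL2,
      IsGaussianProcess.toL2, ← MemLp.toLp_sub]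
    rfl
  -- The characteristic function of a Gaussian increment at `1` determines its variance. As it is
  -- the mean of a bounded function, pathwise continuity and dominated convergence suffice; no
  -- moment domination is needed.
  have hchar : ∀ n, ∫ ω, Complex.exp (D n ω * Complex.I) ∂P =
      Complex.exp ((-(Var[D n; P] / 2) : ℝ)) := fun n => by
    have := (hDg n).charFun_map_eq 1
    rw [charFun_apply_real, integral_map (hDg n).aemeasurable (by fun_prop)] at this
    simpa [hDc n, neg_div] using this
  have hlim : Filter.Tendsto (fun n => ∫ ω, Complex.exp (D n ω * Complex.I) ∂P) Filter.atTop
      (nhds (∫ _, (1 : ℂ) ∂P)) := by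
    refine tendsto_integral_of_dominated_convergence (fun _ => 1) (fun n => ?_)
      (integrable_const _) (fun n => .of_forall fun ω => ?_) (.of_forall fun ω => ?_)
    · have := (hDg n).aemeasurable
      exact AEMeasurable.aestronglyMeasurable (by fun_prop)
    · rw [Complex.norm_exp_ofReal_mul_I]
    · have h1 := (((hX.continuous ω).tendsto x).comp hz).sub_const (X x ω)
      rw [sub_self] at h1
      have h2 : Continuous fun t : ℝ => Complex.exp (t * Complex.I) := by fun_prop
      simpa [Function.comp_def, hD] using (h2.tendsto 0).comp h1
  simp_rw [hchar] at hlim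
  have h3 := hlim.norm
  simp only [Complex.norm_exp_ofReal, integral_const, probReal_univ, one_smul, norm_one] at h3
  have h4 := (Real.continuousAt_log one_ne_zero).tendsto.comp h3
  simp only [Function.comp_def, Real.log_exp, Real.log_one, hnorm] at h4
  have h5 := h4.const_mul (-2)
  have h6 := (Real.continuous_sqrt.tendsto _).comp h5
  rw [tendsto_iff_norm_sub_tendsto_zero]
  simp only [mul_zero, Real.sqrt_zero] at h6
  refine h6.congr fun n => ?_
  rw [Function.comp_apply, show ∀ t : ℝ, -2 * -(t / 2) = t by intro t; ring,
    Real.sqrt_sq (norm_nonneg _)]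
  rfl

lemma IsRegularGaussianField.continuous_covKernel_diag {T : Type*} [MetricSpace T]
    {X : T → Ω → ℝ} (hX : IsRegularGaussianField X P) : Continuous fun x => covKernel X P x x := by
  simp_rw [← hX.gaussian.norm_toL2_sq]
  exact hX.continuous_toL2.norm.pow 2

end GaussianProcess

/-! ### Conditioning on finitely many values; Gaussian vectors. -/

section Comparison

open scoped RealInnerProductSpace

variable {T : Type*} [MetricSpace T] [CompactSpace T] [MeasurableSpace T] [BorelSpace T]
  {lam nu : Measure T} [IsFiniteMeasure lam] [IsFiniteMeasure nu]
  {Ω Ω' : Type*} {mΩ : MeasurableSpace Ω} {mΩ' : MeasurableSpace Ω'}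
  {P : Measure Ω} {P' : Measure Ω'} {X : T → Ω → ℝ} {Y : T → Ω' → ℝ}

-- Orthogonality in `L²` means zero covariance for centered variables, and jointly Gaussian
-- uncorrelated vectors are independent.
omit [CompactSpace T] [MeasurableSpace T] [BorelSpace T] [MetricSpace T] in
lemma ProbabilityTheory.IsGaussianProcess.indepFun_sub_sum_mul {n : ℕ} {s : Fin n → T}
    (hX : IsGaussianProcess X P) (hc : ∀ x, ∫ ω, X x ω ∂P = 0) {x : T} {l : Fin n → ℝ}
    (hl : ∀ i, ⟪hX.toL2 (s i), hX.toL2 x - ∑ j, l j • hX.toL2 (s j)⟫ = 0) :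
    IndepFun (fun ω i => X (s i) ω) (fun ω => X x ω - ∑ j, l j * X (s j) ω) P := by
  have := hX.isProbabilityMeasure
  have hR := hX.hasGaussianLaw_sub_sum_mul x s l
  have hj : HasGaussianLaw (fun ω => (fun i => X (s i) ω,
      fun _ : Unit => X x ω - ∑ j, l j * X (s j) ω)) P := by
    have h := hX.hasGaussianLaw_pi (fun o : Option (Fin n) => o.elim x s)
    let L : (Option (Fin n) → ℝ) →ₗ[ℝ] (Fin n → ℝ) × (Unit → ℝ) :=
      LinearMap.prod (LinearMap.pi fun i => LinearMap.proj (some i))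
        (LinearMap.pi fun _ => LinearMap.proj none - ∑ j, l j • LinearMap.proj (some j))
    refine (h.map_fun (LinearMap.toContinuousLinearMap L)).congr (.of_forall fun ω => ?_)
    ext <;> simp [L]
  have := hj.indepFun_of_covariance_eval fun i _ => by
    have hi := (hX.hasGaussianLaw_eval (s i)).memLp_two
    rw [covariance_eq_sub hi hR.memLp_two, hc, zero_mul, sub_zero, ← hl i,
      ← hX.toLp_sub_sum_mul, L2.inner_def]
    refine integral_congr_ae ?_
    filter_upwards [hi.coeFn_toLp, hR.memLp_two.coeFn_toLp] with ω h1 h2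
    simp only [IsGaussianProcess.toL2, h1, h2, RCLike.inner_apply, conj_trivial, Pi.mul_apply]
    ring
  exact this.comp measurable_id (measurable_pi_apply ())

/-- Replacing a field by its conditional expectation given finitely many of its values decreases
the expectation of a non-decreasing convex function of the balanced ratio. -/
lemma IsRegularGaussianField.lintegral_fieldRatio_projection_le {α γ : ℝ} (hα : 0 < α)
    (hαγ : α < γ) (hlam : lam ≠ 0) (hnu : nu ≠ 0) (hX : IsRegularGaussianField X P)
    {n : ℕ} {s : Fin n → T} {l : T → Fin n → ℝ} (hlc : Continuous l)
    (hl : ∀ x i, ⟪hX.gaussian.toL2 (s i),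
      hX.gaussian.toL2 x - ∑ j, l x j • hX.gaussian.toL2 (s j)⟫ = 0)
    {F : ℝ → ℝ} (hFm : MonotoneOn F (Set.Ioi 0)) (hFc : ConvexOn ℝ (Set.Ioi 0) F)
    (hF0 : ∀ x, 0 < x → 0 ≤ F x) :
    ∫⁻ ω, ENNReal.ofReal (F (fieldRatio α γ lam nu
        (fun x => ∫ ω, (∑ j, l x j * X (s j) ω) ^ 2 ∂P) fun x => ∑ j, l x j * X (s j) ω)) ∂P ≤
      ∫⁻ ω, ENNReal.ofReal (F (fieldRatio α γ lam nu
        (fun x => covKernel X P x x) fun x => X x ω)) ∂P := by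
  have := hX.gaussian.isProbabilityMeasure
  have hm : Measurable fun ω i => X (s i) ω := measurable_pi_lambda _ fun i => hX.measurable _
  have hlj : ∀ j, Continuous fun x => l x j := fun j => (continuous_apply j).comp hlc
  refine lintegral_fieldRatio_le_of_indep hm.comap_le hα hαγ hlam hnu ?_
    hX.continuous_covKernel_diag (fun ω => by fun_prop) hX.continuous (fun x => ?_) hX.measurable
    (fun x => (IndepFun_iff_Indep _ _ _).1
      (hX.gaussian.indepFun_sub_sum_mul hX.centered (hl x)))
    (fun x => hX.gaussian.hasGaussianLaw_sub_sum_mul x s (l x)) (fun x => ?_) (fun x => ?_)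
    hFm hFc hF0
  · simp_rw [hX.gaussian.integral_sum_mul_sq]
    fun_prop
  · refine Finset.measurable_sum _ fun j _ => Measurable.const_mul ?_ _
    exact (measurable_pi_apply j).comp (comap_measurable fun ω i => X (s i) ω)
  · rw [integral_sub (hX.gaussian.hasGaussianLaw_eval _).integrable
      (hX.gaussian.hasGaussianLaw_sum_mul _ _).integrable, hX.centered,
      hX.gaussian.integral_sum_mul hX.centered, sub_zero]
  · rw [integral_sq_eq_norm_toLp_sq (hX.gaussian.hasGaussianLaw_sum_mul s (l x)).memLp_two,
      integral_sq_eq_norm_toLp_sq (hX.gaussian.hasGaussianLaw_sub_sum_mul x s (l x)).memLp_two,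
      hX.gaussian.toLp_sum_mul, hX.gaussian.toLp_sub_sum_mul, ← hX.gaussian.norm_toL2_sq]
    -- Pythagoras: the variance of `X x` is that of the projection plus that of the residual.
    set p := ∑ j, l x j • hX.gaussian.toL2 (s j)
    have h0 : ⟪p, hX.gaussian.toL2 x - p⟫ = 0 := by
      simp only [p, sum_inner, real_inner_smul_left, hl, mul_zero, Finset.sum_const_zero]
    have := norm_add_sq_real p (hX.gaussian.toL2 x - p)
    rw [h0, add_sub_cancel] at this
    linarith

omit [CompactSpace T] [MeasurableSpace T] [BorelSpace T] in
lemma IsRegularGaussianField.charFun_map_toLp (hX : IsRegularGaussianField X P) {n : ℕ}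
    (s : Fin n → T) (t : EuclideanSpace ℝ (Fin n)) :
    charFun (P.map fun ω => WithLp.toLp 2 fun i => X (s i) ω) t =
      Complex.exp ((-((∑ i, ∑ j, t i * t j * covKernel X P (s i) (s j)) / 2) : ℝ)) := by
  have hin : ∀ ω, ⟪t, WithLp.toLp 2 fun i => X (s i) ω⟫ = ∑ j, t j * X (s j) ω := fun ω => by
    simp [PiLp.inner_apply, mul_comm]
  have hg := hX.gaussian.hasGaussianLaw_sum_mul s t
  rw [((hX.gaussian.hasGaussianLaw_pi s).toLp_pi 2).charFun_map_eq]
  simp_rw [hin]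
  rw [variance_of_integral_eq_zero hg.aemeasurable (hX.gaussian.integral_sum_mul hX.centered _ _),
    hX.gaussian.integral_sum_mul hX.centered, hX.gaussian.integral_sum_mul_sq]
  push_cast
  congr 1
  ring

lemma isGaussianProcess_multivariateGaussian {n : ℕ} (D : Matrix (Fin n) (Fin n) ℝ) :
    IsGaussianProcess (fun i (e : EuclideanSpace ℝ (Fin n)) => e i) (multivariateGaussian 0 D) where
  hasGaussianLaw I := (IsGaussian.hasGaussianLaw_id (μ := multivariateGaussian 0 D)).map_fun
    (ContinuousLinearMap.pi fun i : I => EuclideanSpace.proj (i : Fin n))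

lemma integral_eval_multivariateGaussian {n : ℕ} (D : Matrix (Fin n) (Fin n) ℝ) (i : Fin n) :
    ∫ e, e i ∂(multivariateGaussian 0 D) = 0 := by
  have h := (EuclideanSpace.proj i : EuclideanSpace ℝ (Fin n) →L[ℝ] ℝ).integral_comp_id_comm
    (μ := multivariateGaussian 0 D) IsGaussian.integrable_id
  rw [integral_id_multivariateGaussian] at h
  simpa using h

lemma covKernel_multivariateGaussian {n : ℕ} {D : Matrix (Fin n) (Fin n) ℝ} (hD : D.PosSemidef)
    (i j : Fin n) :
    covKernel (fun i (e : EuclideanSpace ℝ (Fin n)) => e i) (multivariateGaussian 0 D) i j =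
      D i j := by
  have h := isGaussianProcess_multivariateGaussian D
  rw [← covariance_eval_multivariateGaussian (μ := 0) hD i j,
    covariance_eq_sub (h.hasGaussianLaw_eval i).memLp_two (h.hasGaussianLaw_eval j).memLp_two,
    integral_eval_multivariateGaussian, zero_mul, sub_zero]
  rfl

end Comparison

/-! ### Comparison of finite linear combinations. -/

section FiniteComparison

open scoped RealInnerProductSpace

variable {T : Type*} [MetricSpace T] [CompactSpace T] [MeasurableSpace T] [BorelSpace T]
  {lam nu : Measure T} [IsFiniteMeasure lam] [IsFiniteMeasure nu]
  {Ω Ω' : Type*} {mΩ : MeasurableSpace Ω} {mΩ' : MeasurableSpace Ω'}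
  {P : Measure Ω} {P' : Measure Ω'} {X : T → Ω → ℝ} {Y : T → Ω' → ℝ}

/-- `F` is arbitrary off `(0, ∞)`. Since the ratio is positive, `F` can be replaced by its indicator
on that interval, measurable because a convex function is continuous on an open interval. -/
lemma measurable_comp_fieldRatio {α γ : ℝ} (hlam : lam ≠ 0) (hnu : nu ≠ 0) {u : T → ℝ}
    {U : T → Ω → ℝ} (hu : Continuous u) (hUc : ∀ ω, Continuous fun x => U x ω)
    (hUm : ∀ x, Measurable (U x)) {F : ℝ → ℝ} (hFc : ConvexOn ℝ (Set.Ioi 0) F) :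
    Measurable fun ω => F (fieldRatio α γ lam nu u fun x => U x ω) := by
  have hind : Measurable ((Set.Ioi 0).indicator F) :=
    (hFc.continuousOn isOpen_Ioi).measurable_piecewise continuousOn_const measurableSet_Ioi
  have : (fun ω => F (fieldRatio α γ lam nu u fun x => U x ω)) =
      fun ω => (Set.Ioi 0).indicator F (fieldRatio α γ lam nu u fun x => U x ω) :=
    funext fun ω => (Set.indicator_of_mem
      (show _ ∈ Set.Ioi (0 : ℝ) from fieldRatio_pos α γ hlam hnu hu (hUc ω)) F).symm
  rw [this]
  exact hind.comp (measurable_fieldRatio α γ hu hUc hUm)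

omit [CompactSpace T] [MeasurableSpace T] [BorelSpace T] in
lemma IsRegularGaussianField.measurable_toLp (hX : IsRegularGaussianField X P) {n : ℕ}
    (s : Fin n → T) : Measurable fun ω => WithLp.toLp 2 fun i => X (s i) ω :=
  (WithLp.measurable_toLp 2 _).comp (measurable_pi_lambda _ fun _ => hX.measurable _)

omit [CompactSpace T] [MeasurableSpace T] [BorelSpace T] in
/-- Adding an independent Gaussian vector to the values of `X` gives the values of `Y` in law. -/
lemma IsRegularGaussianField.map_prod_add_eq (hX : IsRegularGaussianField X P)
    (hY : IsRegularGaussianField Y P') {n : ℕ} {s : Fin n → T} {D : Matrix (Fin n) (Fin n) ℝ}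
    (hD : D.PosSemidef)
    (hDs : ∀ i j, D i j = covKernel Y P' (s i) (s j) - covKernel X P (s i) (s j)) :
    (P.prod (multivariateGaussian 0 D)).map
        (fun p => (WithLp.toLp 2 fun i => X (s i) p.1) + p.2) =
      P'.map fun ω => WithLp.toLp 2 fun i => Y (s i) ω := by
  have := hX.gaussian.isProbabilityMeasure
  have := hY.gaussian.isProbabilityMeasure
  have hmX := hX.measurable_toLp s
  have hmY := hY.measurable_toLp s
  have h1 : (P.prod (multivariateGaussian 0 D)).map
      (fun p => (WithLp.toLp 2 fun i => X (s i) p.1) + p.2) =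
      (P.map fun ω => WithLp.toLp 2 fun i => X (s i) ω) ∗ multivariateGaussian 0 D := by
    rw [Measure.conv, ← Measure.map_id (μ := multivariateGaussian 0 D),
      Measure.map_prod_map _ _ hmX measurable_id,
      Measure.map_map (by fun_prop) (by fun_prop), Measure.map_id]
    rfl
  have := Measure.isProbabilityMeasure_map (μ := P) hmX.aemeasurable
  have := Measure.isProbabilityMeasure_map (μ := P') hmY.aemeasurable
  rw [h1]
  refine Measure.ext_of_charFun (funext fun t => ?_)
  rw [charFun_conv, hX.charFun_map_toLp, hY.charFun_map_toLp,
    charFun_multivariateGaussian hD, ← Complex.exp_add]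
  congr 1
  simp only [dotProduct, Matrix.mulVec, hDs, inner_zero_right, Finset.mul_sum]
  push_cast
  simp only [mul_sub, sub_mul, Finset.sum_sub_distrib]
  simp only [← mul_assoc, mul_comm]
  ring

/-- Adding an independent centered Gaussian field on a product space increases the expectation of a
non-decreasing convex function of the balanced ratio. -/
lemma lintegral_fieldRatio_le_prod {α γ : ℝ} (hα : 0 < α) (hαγ : α < γ)
    (hlam : lam ≠ 0) (hnu : nu ≠ 0) [IsProbabilityMeasure P] [IsProbabilityMeasure P']
    {u v : T → ℝ} {U : T → Ω → ℝ} {R : T → Ω' → ℝ} (hu : Continuous u) (hv : Continuous v)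
    (hUc : ∀ ω, Continuous fun x => U x ω) (hRc : ∀ ω, Continuous fun x => R x ω)
    (hUm : ∀ x, Measurable (U x)) (hRm : ∀ x, Measurable (R x))
    (hRg : ∀ x, HasGaussianLaw (R x) P') (hR0 : ∀ x, ∫ ω, R x ω ∂P' = 0)
    (huv : ∀ x, v x = u x + ∫ ω, R x ω ^ 2 ∂P')
    {F : ℝ → ℝ} (hFm : MonotoneOn F (Set.Ioi 0)) (hFc : ConvexOn ℝ (Set.Ioi 0) F)
    (hF0 : ∀ x, 0 < x → 0 ≤ F x) :
    ∫⁻ ω, ENNReal.ofReal (F (fieldRatio α γ lam nu u fun x => U x ω)) ∂P ≤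
      ∫⁻ p, ENNReal.ofReal (F (fieldRatio α γ lam nu v fun x => U x p.1 + R x p.2))
        ∂(P.prod P') := by
  rw [← (measurePreserving_fst (μ := P) (ν := P')).lintegral_comp
    (measurable_comp_fieldRatio hlam hnu hu hUc hUm hFc).ennreal_ofReal]
  refine lintegral_fieldRatio_le_of_indep (m := MeasurableSpace.comap Prod.fst mΩ)
    (U := fun x p => U x p.1) (V := fun x p => U x p.1 + R x p.2) measurable_fst.comap_le hα hαγ
    hlam hnu hu hv (fun p => hUc p.1) (fun p => (hUc p.1).add (hRc p.2))
    (fun x => (hUm x).comp (comap_measurable Prod.fst))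
    (fun x => ((hUm x).comp measurable_fst).add ((hRm x).comp measurable_snd))
    (fun x => ?_) (fun x => ?_) (fun x => ?_) (fun x => ?_) hFm hFc hF0
  · simp_rw [add_sub_cancel_left]
    exact (IndepFun_iff_Indep _ _ _).1 (indepFun_prod (X := fun ω : Ω => ω) measurable_id (hRm x))
  · simp_rw [add_sub_cancel_left]
    constructor
    have := (hRg x).isGaussian_map
    rwa [← (measurePreserving_snd (μ := P) (ν := P')).map_eq,
      Measure.map_map (hRm x) measurable_snd] at this
  · simp_rw [add_sub_cancel_left]
    rw [integral_fun_snd, hR0, smul_zero]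
  · simp_rw [add_sub_cancel_left]
    rw [integral_fun_snd (fun ω => R x ω ^ 2), huv x]
    simp

/-- The comparison of fields that are finite linear combinations. -/
lemma lintegral_fieldRatio_sum_mul_le {α γ : ℝ} (hα : 0 < α)
    (hαγ : α < γ) (hlam : lam ≠ 0) (hnu : nu ≠ 0) (hX : IsRegularGaussianField X P)
    (hY : IsRegularGaussianField Y P') {n : ℕ} {s : Fin n → T}
    {D : Matrix (Fin n) (Fin n) ℝ} (hD : D.PosSemidef)
    (hDs : ∀ i j, D i j = covKernel Y P' (s i) (s j) - covKernel X P (s i) (s j))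
    {l : T → Fin n → ℝ} (hlc : Continuous l)
    {F : ℝ → ℝ} (hFm : MonotoneOn F (Set.Ioi 0)) (hFc : ConvexOn ℝ (Set.Ioi 0) F)
    (hF0 : ∀ x, 0 < x → 0 ≤ F x) :
    ∫⁻ ω, ENNReal.ofReal (F (fieldRatio α γ lam nu
        (fun x => ∫ ω, (∑ j, l x j * X (s j) ω) ^ 2 ∂P) fun x => ∑ j, l x j * X (s j) ω)) ∂P ≤
      ∫⁻ ω, ENNReal.ofReal (F (fieldRatio α γ lam nu
        (fun x => ∫ ω, (∑ j, l x j * Y (s j) ω) ^ 2 ∂P') fun x => ∑ j, l x j * Y (s j) ω)) ∂P' := by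
  have := hX.gaussian.isProbabilityMeasure
  have := hY.gaussian.isProbabilityMeasure
  have hlj : ∀ j, Continuous fun x => l x j := fun j => (continuous_apply j).comp hlc
  have huv : ∀ x, ∫ ω, (∑ j, l x j * Y (s j) ω) ^ 2 ∂P' =
      ∫ ω, (∑ j, l x j * X (s j) ω) ^ 2 ∂P +
        ∫ e : EuclideanSpace ℝ (Fin n), (∑ j, l x j * e j) ^ 2 ∂(multivariateGaussian 0 D) := by
    intro x
    rw [hX.gaussian.integral_sum_mul_sq, hY.gaussian.integral_sum_mul_sq,
      (isGaussianProcess_multivariateGaussian D).integral_sum_mul_sq (fun j => j) (l x)]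
    simp only [covKernel_multivariateGaussian hD, hDs, mul_sub, Finset.sum_sub_distrib]
    ring
  have huc : Continuous fun x => ∫ ω, (∑ j, l x j * X (s j) ω) ^ 2 ∂P := by
    simp_rw [hX.gaussian.integral_sum_mul_sq]
    fun_prop
  have hvc : Continuous fun x => ∫ ω, (∑ j, l x j * Y (s j) ω) ^ 2 ∂P' := by
    simp_rw [hY.gaussian.integral_sum_mul_sq]
    fun_prop
  have hgp := isGaussianProcess_multivariateGaussian D
  have hXm := hX.measurable
  have hadd : Measurable fun p : Ω × EuclideanSpace ℝ (Fin n) =>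
      (WithLp.toLp 2 fun i => X (s i) p.1) + p.2 :=
    ((hX.measurable_toLp s).comp measurable_fst).add measurable_snd
  have hFm' := (measurable_comp_fieldRatio (lam := lam) (nu := nu) (α := α) (γ := γ)
    (U := fun x (e : EuclideanSpace ℝ (Fin n)) => ∑ j, l x j * e j) hlam hnu hvc
    (fun e => by fun_prop) (fun x => by fun_prop) hFc).ennreal_ofReal
  refine (lintegral_fieldRatio_le_prod (P' := multivariateGaussian 0 D)
    (R := fun x (e : EuclideanSpace ℝ (Fin n)) => ∑ j, l x j * e j) hα hαγ hlam hnu huc hvc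
    (fun ω => by fun_prop) (fun e => by fun_prop) (fun x => by fun_prop) (fun x => by fun_prop)
    (fun x => hgp.hasGaussianLaw_sum_mul (fun j => j) (l x))
    (fun x => hgp.integral_sum_mul (integral_eval_multivariateGaussian D) (fun j => j) (l x))
    huv hFm hFc hF0).trans (le_of_eq ?_)
  -- Both integrands depend only on the vector of values at the points `s j`, whose laws agree by
  -- `map_prod_add_eq`.
  rw [← lintegral_map hFm' (hY.measurable_toLp s), ← hX.map_prod_add_eq hY hD hDs,
    lintegral_map hFm' hadd]
  simp [mul_add, Finset.sum_add_distrib]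

end FiniteComparison

/-! ### `L¹` estimates for exponential martingales. -/

section Exponential

variable {Ω : Type*} {mΩ : MeasurableSpace Ω} {P : Measure Ω}

lemma integral_abs_sub_le_sqrt [IsProbabilityMeasure P] {M N : Ω → ℝ}
    (hM : AEStronglyMeasurable M P) (hN : AEStronglyMeasurable N P)
    (hMM : Integrable (fun ω => M ω ^ 2) P) (hNN : Integrable (fun ω => N ω ^ 2) P)
    (hMN : Integrable (fun ω => M ω * N ω) P) :
    ∫ ω, |M ω - N ω| ∂P ≤
      √(∫ ω, M ω ^ 2 ∂P + ∫ ω, N ω ^ 2 ∂P - 2 * ∫ ω, M ω * N ω ∂P) := by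
  have hsq : ∀ ω, |M ω - N ω| ^ 2 = M ω ^ 2 + N ω ^ 2 - 2 * (M ω * N ω) := fun ω => by
    rw [sq_abs]; ring
  have hL : MemLp (fun ω => |M ω - N ω|) 2 P := by
    refine (memLp_two_iff_integrable_sq (hM.sub hN).norm).2 ?_
    exact ((hMM.add hNN).sub (hMN.const_mul 2)).congr (.of_forall fun ω => (hsq ω).symm)
  refine Real.le_sqrt_of_sq_le ?_
  -- Cauchy–Schwarz in the form that the variance of `|M - N|` is non-negative.
  have h := variance_nonneg (fun ω => |M ω - N ω|) P
  rw [variance_eq_sub hL] at h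
  simp only [Pi.pow_apply, hsq] at h
  have e : ∫ ω, (M ω ^ 2 + N ω ^ 2 - 2 * (M ω * N ω)) ∂P =
      ∫ ω, M ω ^ 2 ∂P + ∫ ω, N ω ^ 2 ∂P - 2 * ∫ ω, M ω * N ω ∂P := by
    rw [← integral_const_mul, ← integral_add hMM hNN]
    exact integral_sub (hMM.add hNN) (hMN.const_mul 2)
  linarith

/-- The `L¹` distance of two exponential martingales. -/
lemma lintegral_enorm_exp_sub_exp_le {W Z : Ω → ℝ} (hW : HasGaussianLaw W P)
    (hZ : HasGaussianLaw Z P) (hWZ : HasGaussianLaw (fun ω => W ω + Z ω) P)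
    (hWc : ∫ ω, W ω ∂P = 0) (hZc : ∫ ω, Z ω ∂P = 0) (β : ℝ) :
    ∫⁻ ω, ‖Real.exp (β * W ω - β ^ 2 / 2 * ∫ ω', W ω' ^ 2 ∂P) -
        Real.exp (β * Z ω - β ^ 2 / 2 * ∫ ω', Z ω' ^ 2 ∂P)‖ₑ ∂P ≤
      ENNReal.ofReal √(Real.exp (β ^ 2 * ∫ ω, W ω ^ 2 ∂P) + Real.exp (β ^ 2 * ∫ ω, Z ω ^ 2 ∂P)
        - 2 * Real.exp (β ^ 2 / 2 * (∫ ω, (W ω + Z ω) ^ 2 ∂P - ∫ ω, W ω ^ 2 ∂P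
          - ∫ ω, Z ω ^ 2 ∂P))) := by
  have := hW.isProbabilityMeasure
  have hc : ∫ ω, (W ω + Z ω) ∂P = 0 := by
    rw [integral_add hW.integrable hZ.integrable, hWc, hZc, add_zero]
  obtain ⟨i1, -⟩ := integrable_exp_gaussian hW hWc β
  obtain ⟨i2, -⟩ := integrable_exp_gaussian hZ hZc β
  obtain ⟨j1, e1⟩ := integrable_exp_gaussian hW hWc (2 * β)
  obtain ⟨j2, e2⟩ := integrable_exp_gaussian hZ hZc (2 * β)
  obtain ⟨j3, e3⟩ := integrable_exp_gaussian hWZ hc β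
  set a := ∫ ω, W ω ^ 2 ∂P
  set b := ∫ ω, Z ω ^ 2 ∂P
  set c := ∫ ω, (W ω + Z ω) ^ 2 ∂P
  -- Squares and products of normalised exponentials are constants times normalised exponentials, of
  -- `2 * β` or of `W + Z`; these have mean one, so all second moments are explicit.
  have f1 : ∀ ω, Real.exp (β * W ω - β ^ 2 / 2 * a) ^ 2 =
      Real.exp (β ^ 2 * a) * Real.exp (2 * β * W ω - (2 * β) ^ 2 / 2 * a) := fun ω => by
    rw [← Real.exp_nat_mul, ← Real.exp_add]; congr 1; push_cast; ring
  have f2 : ∀ ω, Real.exp (β * Z ω - β ^ 2 / 2 * b) ^ 2 =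
      Real.exp (β ^ 2 * b) * Real.exp (2 * β * Z ω - (2 * β) ^ 2 / 2 * b) := fun ω => by
    rw [← Real.exp_nat_mul, ← Real.exp_add]; congr 1; push_cast; ring
  have f3 : ∀ ω, Real.exp (β * W ω - β ^ 2 / 2 * a) * Real.exp (β * Z ω - β ^ 2 / 2 * b) =
      Real.exp (β ^ 2 / 2 * (c - a - b)) * Real.exp (β * (W ω + Z ω) - β ^ 2 / 2 * c) := fun ω => by
    rw [← Real.exp_add, ← Real.exp_add]; congr 1; ring
  have key := integral_abs_sub_le_sqrt i1.aestronglyMeasurable i2.aestronglyMeasurable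
    ((j1.const_mul _).congr (.of_forall fun ω => (f1 ω).symm))
    ((j2.const_mul _).congr (.of_forall fun ω => (f2 ω).symm))
    ((j3.const_mul _).congr (.of_forall fun ω => (f3 ω).symm))
  simp_rw [f1, f2, f3, integral_const_mul, e1, e2, e3, mul_one] at key
  exact (ofReal_integral_norm_eq_lintegral_enorm (i1.sub i2)).symm.le.trans
    (ENNReal.ofReal_le_ofReal key)

lemma lintegral_enorm_exp_sub_exp_le_two {W Z : Ω → ℝ} (hW : HasGaussianLaw W P)
    (hZ : HasGaussianLaw Z P) (hWc : ∫ ω, W ω ∂P = 0) (hZc : ∫ ω, Z ω ∂P = 0) (β : ℝ) :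
    ∫⁻ ω, ‖Real.exp (β * W ω - β ^ 2 / 2 * ∫ ω', W ω' ^ 2 ∂P) -
        Real.exp (β * Z ω - β ^ 2 / 2 * ∫ ω', Z ω' ^ 2 ∂P)‖ₑ ∂P ≤ 2 := by
  have i1 := (integrable_exp_gaussian hW hWc β).1
  calc
    _ ≤ ∫⁻ ω, (ENNReal.ofReal (Real.exp (β * W ω - β ^ 2 / 2 * ∫ ω', W ω' ^ 2 ∂P)) +
        ENNReal.ofReal (Real.exp (β * Z ω - β ^ 2 / 2 * ∫ ω', Z ω' ^ 2 ∂P))) ∂P := by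
      refine lintegral_mono fun ω => (enorm_sub_le).trans (le_of_eq ?_)
      rw [Real.enorm_of_nonneg (Real.exp_pos _).le, Real.enorm_of_nonneg (Real.exp_pos _).le]
    _ = 2 := by
      rw [lintegral_add_left' i1.aemeasurable.ennreal_ofReal, lintegral_exp_gaussian hW hWc,
        lintegral_exp_gaussian hZ hZc, one_add_one_eq_two]

end Exponential

/-! ### Convergence of masses and lower semicontinuity. -/

section Limit

open Filter Topology

variable {T : Type*} [MetricSpace T] [CompactSpace T] [MeasurableSpace T] [BorelSpace T]
  {μ lam nu : Measure T} [IsFiniteMeasure μ] [IsFiniteMeasure lam] [IsFiniteMeasure nu]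
  {Ω : Type*} {mΩ : MeasurableSpace Ω} {P : Measure Ω}

/-- Tonelli bounds the `L¹` distance of the masses by the integral over `x` of the pointwise `L¹`
distances; these are dominated by `2`, integrable since `μ` is finite. -/
lemma tendsto_lintegral_enorm_fieldMass_sub [IsProbabilityMeasure P] {β : ℝ} {u : T → ℝ}
    {U : T → Ω → ℝ} {un : ℕ → T → ℝ} {Un : ℕ → T → Ω → ℝ}
    (hu : Continuous u) (hUc : ∀ ω, Continuous fun x => U x ω) (hUm : ∀ x, Measurable (U x))
    (hun : ∀ n, Continuous (un n)) (hUnc : ∀ n ω, Continuous fun x => Un n x ω)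
    (hUnm : ∀ n x, Measurable (Un n x))
    (hb : ∀ n x, ∫⁻ ω, ‖Real.exp (β * Un n x ω - β ^ 2 / 2 * un n x) -
      Real.exp (β * U x ω - β ^ 2 / 2 * u x)‖ₑ ∂P ≤ 2)
    (hl : ∀ x, Tendsto (fun n => ∫⁻ ω, ‖Real.exp (β * Un n x ω - β ^ 2 / 2 * un n x) -
      Real.exp (β * U x ω - β ^ 2 / 2 * u x)‖ₑ ∂P) atTop (𝓝 0)) :
    Tendsto (fun n => ∫⁻ ω, ‖fieldMass β μ (un n) (fun x => Un n x ω) -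
      fieldMass β μ u (fun x => U x ω)‖ₑ ∂P) atTop (𝓝 0) := by
  have hj : ∀ n, Measurable fun p : T × Ω => ‖Real.exp (β * Un n p.1 p.2 - β ^ 2 / 2 * un n p.1) -
      Real.exp (β * U p.1 p.2 - β ^ 2 / 2 * u p.1)‖ₑ := fun n =>
    ((measurable_exp_field β (hun n) (hUnc n) (hUnm n)).sub
      (measurable_exp_field β hu hUc hUm)).enorm
  have hlim := tendsto_lintegral_of_dominated_convergence (μ := μ) (f := fun _ => 0)
    (F := fun n x => ∫⁻ ω, ‖Real.exp (β * Un n x ω - β ^ 2 / 2 * un n x) -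
      Real.exp (β * U x ω - β ^ 2 / 2 * u x)‖ₑ ∂P) (fun _ => 2)
    (fun n => (hj n).lintegral_prod_right') (fun n => .of_forall (hb n))
    (by simp [ENNReal.mul_eq_top]) (.of_forall hl)
  rw [lintegral_zero] at hlim
  refine tendsto_of_tendsto_of_tendsto_of_le_of_le tendsto_const_nhds hlim (fun _ => bot_le)
    fun n => ?_
  dsimp only
  rw [lintegral_lintegral_swap (hj n).aemeasurable]
  refine lintegral_mono fun ω => ?_
  rw [fieldMass, fieldMass, ← integral_sub (integrable_exp_field β (hun n) (hUnc n ω))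
    (integrable_exp_field β hu (hUc ω))]
  exact enorm_integral_le_lintegral_enorm _

/-- Lower semicontinuity of the expectation of a function of the balanced ratio. -/
lemma lintegral_fieldRatio_le_of_tendsto [IsProbabilityMeasure P] {α γ : ℝ} (hlam : lam ≠ 0)
    (hnu : nu ≠ 0) {u : T → ℝ}
    {U : T → Ω → ℝ} {un : ℕ → T → ℝ} {Un : ℕ → T → Ω → ℝ}
    (hu : Continuous u) (hUc : ∀ ω, Continuous fun x => U x ω) (hUm : ∀ x, Measurable (U x))
    (hun : ∀ n, Continuous (un n)) (hUnc : ∀ n ω, Continuous fun x => Un n x ω)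
    (hUnm : ∀ n x, Measurable (Un n x))
    (hA : Tendsto (fun n => ∫⁻ ω, ‖fieldMass α lam (un n) (fun x => Un n x ω) -
      fieldMass α lam u (fun x => U x ω)‖ₑ ∂P) atTop (𝓝 0))
    (hB : Tendsto (fun n => ∫⁻ ω, ‖fieldMass γ nu (un n) (fun x => Un n x ω) -
      fieldMass γ nu u (fun x => U x ω)‖ₑ ∂P) atTop (𝓝 0))
    {F : ℝ → ℝ} (hFc : ConvexOn ℝ (Set.Ioi 0) F) {C : ℝ≥0∞}
    (hC : ∀ n, ∫⁻ ω, ENNReal.ofReal (F (fieldRatio α γ lam nu (un n) fun x => Un n x ω)) ∂P ≤ C) :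
    ∫⁻ ω, ENNReal.ofReal (F (fieldRatio α γ lam nu u fun x => U x ω)) ∂P ≤ C := by
  simp_rw [← eLpNorm_one_eq_lintegral_enorm] at hA hB
  have mA := fun n => (measurable_fieldMass (μ := lam) α (hun n) (hUnc n) (hUnm n))
  have mB := fun n => (measurable_fieldMass (μ := nu) γ (hun n) (hUnc n) (hUnm n))
  -- Almost sure convergence of both masses: a subsequence `k` for the first, then a further one `j`
  -- along `k` for the second.
  obtain ⟨k, hk, hkA⟩ := (tendstoInMeasure_of_tendsto_eLpNorm one_ne_zero
    (fun n => (mA n).aestronglyMeasurable)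
    (measurable_fieldMass α hu hUc hUm).aestronglyMeasurable hA).exists_seq_tendsto_ae
  obtain ⟨j, hj, hjB⟩ := (tendstoInMeasure_of_tendsto_eLpNorm one_ne_zero
    (fun n => (mB (k n)).aestronglyMeasurable)
    (measurable_fieldMass γ hu hUc hUm).aestronglyMeasurable
    (hB.comp hk.tendsto_atTop)).exists_seq_tendsto_ae
  calc
    _ = ∫⁻ ω, liminf (fun n => ENNReal.ofReal (F (fieldRatio α γ lam nu (un (k (j n)))
          fun x => Un (k (j n)) x ω))) atTop ∂P := by
      refine lintegral_congr_ae ?_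
      filter_upwards [hkA, hjB] with ω h1 h2
      refine (Tendsto.liminf_eq ?_).symm
      refine (ENNReal.continuous_ofReal.tendsto _).comp ?_
      have hpos := fieldRatio_pos α γ hlam hnu hu (hUc ω)
      refine ((hFc.continuousOn isOpen_Ioi).continuousAt (isOpen_Ioi.mem_nhds hpos)).tendsto.comp ?_
      have hpA := fieldMass_pos α hlam hu (hUc ω)
      have hpB := fieldMass_pos γ hnu hu (hUc ω)
      exact ((h1.comp hj.tendsto_atTop).rpow_const (.inl hpA.ne')).div
        (h2.rpow_const (.inl hpB.ne')) (Real.rpow_pos_of_pos hpB _).ne'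
    _ ≤ liminf (fun n => ∫⁻ ω, ENNReal.ofReal (F (fieldRatio α γ lam nu (un (k (j n)))
          fun x => Un (k (j n)) x ω)) ∂P) atTop :=
      lintegral_liminf_le fun n =>
        (measurable_comp_fieldRatio hlam hnu (hun _) (hUnc _) (hUnm _) hFc).ennreal_ofReal
    _ ≤ C := liminf_le_of_frequently_le' (Frequently.of_forall fun n => hC _)

end Limit

/-! ### The comparison for regular fields. -/

section Main

open Filter Topology

variable {T Ω Ω' : Type*} {mΩ : MeasurableSpace Ω} {mΩ' : MeasurableSpace Ω'}
  {P : Measure Ω} {P' : Measure Ω'} {X : T → Ω → ℝ} {Y : T → Ω' → ℝ}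

lemma integral_sum_mul_sq_le (hX : IsGaussianProcess X P) (hY : IsGaussianProcess Y P')
    (hXY : (Matrix.of fun x y => covKernel Y P' x y - covKernel X P x y).PosSemidef)
    {ι : Type*} [Fintype ι] (s : ι → T) (c : ι → ℝ) :
    ∫ ω, (∑ j, c j * X (s j) ω) ^ 2 ∂P ≤ ∫ ω, (∑ j, c j * Y (s j) ω) ^ 2 ∂P' := by
  rw [hX.integral_sum_mul_sq, hY.integral_sum_mul_sq, ← sub_nonneg, ← Finset.sum_sub_distrib]
  refine ((hXY.submatrix s).dotProduct_mulVec_nonneg c).trans_eq ?_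
  simp only [dotProduct, Matrix.mulVec, Finset.mul_sum, ← Finset.sum_sub_distrib]
  refine Finset.sum_congr rfl fun i _ => Finset.sum_congr rfl fun j _ => ?_
  simp only [star_trivial, Matrix.submatrix_apply, Matrix.of_apply]
  ring

/-- Approximation errors for `X` are controlled by those for `Y` with the same coefficients: this is
positivity of the difference kernel tested on the points `x, s j` with weights `1, -l j`. -/
lemma norm_toL2_sub_sum_le (hX : IsGaussianProcess X P) (hY : IsGaussianProcess Y P')
    (hXY : (Matrix.of fun x y => covKernel Y P' x y - covKernel X P x y).PosSemidef)
    {ι : Type*} [Fintype ι] (x : T) (s : ι → T) (l : ι → ℝ) :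
    ‖hX.toL2 x - ∑ j, l j • hX.toL2 (s j)‖ ≤ ‖hY.toL2 x - ∑ j, l j • hY.toL2 (s j)‖ := by
  have h := integral_sum_mul_sq_le hX hY hXY (fun o : Option ι => o.elim x s)
    (fun o => o.elim 1 (-l))
  simp only [Fintype.sum_option, Option.elim_none, Option.elim_some, one_mul, Pi.neg_apply,
    neg_mul, Finset.sum_neg_distrib, ← sub_eq_add_neg] at h
  rw [integral_sq_eq_norm_toLp_sq (hX.hasGaussianLaw_sub_sum_mul x s l).memLp_two,
    integral_sq_eq_norm_toLp_sq (hY.hasGaussianLaw_sub_sum_mul x s l).memLp_two,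
    hX.toLp_sub_sum_mul, hY.toLp_sub_sum_mul] at h
  exact (sq_le_sq₀ (norm_nonneg _) (norm_nonneg _)).1 h

/-- Mean square convergence of Gaussian variables gives `L¹` convergence of their exponential
martingales. -/
lemma tendsto_lintegral_enorm_exp_sub_exp (hX : IsGaussianProcess X P)
    (hc : ∀ x, ∫ ω, X x ω ∂P = 0) (x : T) (s : ℕ → T) (l : ∀ n, Fin n → ℝ)
    (hl : Tendsto (fun n => ∑ j, l n j • hX.toL2 (s j)) atTop (𝓝 (hX.toL2 x))) (β : ℝ) :
    Tendsto (fun n => ∫⁻ ω, ‖Real.exp (β * ∑ j, l n j * X (s j) ω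
        - β ^ 2 / 2 * ∫ ω', (∑ j, l n j * X (s j) ω') ^ 2 ∂P) -
      Real.exp (β * X x ω - β ^ 2 / 2 * covKernel X P x x)‖ₑ ∂P) atTop (𝓝 0) := by
  have hcov : covKernel X P x x = ∫ ω, X x ω ^ 2 ∂P := by simp only [covKernel, sq]
  have hadd : ∀ n, HasGaussianLaw (fun ω => ∑ j, l n j * X (s j) ω + X x ω) P := fun n => by
    have := hX.hasGaussianLaw_sub_sum_mul x (fun j : Fin n => s j) (-l n)
    refine this.congr (.of_forall fun ω => ?_)
    simp [add_comm]
  have e1 : ∀ n, ∫ ω, (∑ j, l n j * X (s j) ω) ^ 2 ∂P = ‖∑ j, l n j • hX.toL2 (s j)‖ ^ 2 :=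
    fun n => by
      rw [integral_sq_eq_norm_toLp_sq
        (hX.hasGaussianLaw_sum_mul (fun j : Fin n => s j) (l n)).memLp_two, hX.toLp_sum_mul]
  have e2 : ∫ ω, X x ω ^ 2 ∂P = ‖hX.toL2 x‖ ^ 2 := by rw [← hcov, hX.norm_toL2_sq]
  have e3 : ∀ n, ∫ ω, (∑ j, l n j * X (s j) ω + X x ω) ^ 2 ∂P =
      ‖∑ j, l n j • hX.toL2 (s j) + hX.toL2 x‖ ^ 2 := fun n => by
    rw [integral_sq_eq_norm_toLp_sq (hadd n).memLp_two, ← hX.toLp_sum_mul (fun j : Fin n => s j),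
      IsGaussianProcess.toL2, ← MemLp.toLp_add]
    rfl
  have hle : ∀ n, _ := fun n => lintegral_enorm_exp_sub_exp_le
    (hX.hasGaussianLaw_sum_mul (fun j : Fin n => s j) (l n)) (hX.hasGaussianLaw_eval x) (hadd n)
    (hX.integral_sum_mul hc _ _) (hc x) β
  rw [hcov]
  refine tendsto_of_tendsto_of_tendsto_of_le_of_le tendsto_const_nhds ?_ (fun _ => bot_le) hle
  simp_rw [e1, e2, e3]
  set y := hX.toL2 x
  have hcont : Continuous fun z : Lp ℝ 2 P => ENNReal.ofReal √(Real.exp (β ^ 2 * ‖z‖ ^ 2) +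
      Real.exp (β ^ 2 * ‖y‖ ^ 2) -
      2 * Real.exp (β ^ 2 / 2 * (‖z + y‖ ^ 2 - ‖z‖ ^ 2 - ‖y‖ ^ 2))) :=
    ENNReal.continuous_ofReal.comp (by fun_prop)
  have h0 := (hcont.tendsto y).comp hl
  -- At the limit `z = y` the quantity under the square root vanishes.
  have : ‖y + y‖ ^ 2 - ‖y‖ ^ 2 - ‖y‖ ^ 2 = 2 * ‖y‖ ^ 2 := by
    rw [← two_smul ℝ y, norm_smul]; norm_num; ring
  rw [this, show β ^ 2 / 2 * (2 * ‖y‖ ^ 2) = β ^ 2 * ‖y‖ ^ 2 by ring, ← two_mul, sub_self,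
    Real.sqrt_zero, ENNReal.ofReal_zero] at h0
  exact h0

variable [MetricSpace T] [CompactSpace T] [MeasurableSpace T] [BorelSpace T]
  {lam nu : Measure T} [IsFiniteMeasure lam] [IsFiniteMeasure nu]

/-- The comparison for regular fields and non-negative functions. -/
lemma IsRegularGaussianField.lintegral_fieldRatio_le {α γ : ℝ} (hα : 0 < α) (hγ : 0 < γ)
    (hαγ : α ≠ γ) (hlam : lam ≠ 0) (hnu : nu ≠ 0) (hX : IsRegularGaussianField X P)
    (hY : IsRegularGaussianField Y P')
    (hXY : (Matrix.of fun x y => covKernel Y P' x y - covKernel X P x y).PosSemidef)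
    {F : ℝ → ℝ} (hFm : MonotoneOn F (Set.Ioi 0)) (hFc : ConvexOn ℝ (Set.Ioi 0) F)
    (hF0 : ∀ x, 0 < x → 0 ≤ F x) :
    ∫⁻ ω, ENNReal.ofReal (F (fieldRatio α γ lam nu
        (fun x => covKernel X P x x) fun x => X x ω)) ∂P ≤
      ∫⁻ ω, ENNReal.ofReal (F (fieldRatio α γ lam nu
        (fun x => covKernel Y P' x x) fun x => Y x ω)) ∂P' := by
  wlog h : α < γ generalizing α γ lam nu
  · simp_rw [fieldRatio_swap α γ]
    exact this hγ hα hαγ.symm hnu hlam (lt_of_le_of_ne (not_lt.1 h) hαγ.symm)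
  have := hX.gaussian.isProbabilityMeasure
  have : Nonempty T := by
    by_contra hT
    rw [not_nonempty_iff] at hT
    exact hlam (Measure.eq_zero_of_isEmpty lam)
  let s := TopologicalSpace.denseSeq T
  -- The coefficients are the projection coefficients of `Y`, not of `X`: orthogonality is needed
  -- only for `Y`, while `X` needs only convergence.
  choose l hlc hlo hln using fun n =>
    exists_continuous_projection_coeff hY.continuous_toL2 (fun j : Fin n => s j)
  have hlj : ∀ n j, Continuous fun x => l n x j := fun n j => (continuous_apply j).comp (hlc n)
  have hlim : ∀ x, Tendsto (fun n => ∑ j, l n x j • hX.gaussian.toL2 (s j)) atTop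
      (𝓝 (hX.gaussian.toL2 x)) := by
    intro x
    refine Metric.tendsto_atTop.2 fun ε hε => ?_
    obtain ⟨_, hz, N, rfl⟩ := (TopologicalSpace.denseRange_denseSeq T).inter_open_nonempty _
      (hY.continuous_toL2.isOpen_preimage _ (Metric.isOpen_ball (x := hY.gaussian.toL2 x)))
      ⟨x, Metric.mem_ball_self hε⟩
    -- The point `s N` is among `s 0, ..., s (n - 1)` exactly when `n ≥ N + 1`.
    refine ⟨N + 1, fun n hn => ?_⟩
    rw [dist_comm, dist_eq_norm]
    refine (norm_toL2_sub_sum_le hX.gaussian hY.gaussian hXY x (fun j : Fin n => s j)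
      (l n x)).trans_lt ((hln n x ⟨N, hn⟩).trans_lt ?_)
    rwa [← dist_eq_norm, dist_comm]
  have hXm := hX.measurable
  have hXc := hX.continuous
  have hun : ∀ n, Continuous fun x => ∫ ω, (∑ j, l n x j * X (s j) ω) ^ 2 ∂P := fun n => by
    simp_rw [fun x => hX.gaussian.integral_sum_mul_sq (fun j : Fin n => s j) (l n x)]
    fun_prop
  have hmass : ∀ (β : ℝ) (μ : Measure T) [IsFiniteMeasure μ], _ := fun β μ _ =>
    tendsto_lintegral_enorm_fieldMass_sub (μ := μ) (β := β)
      (Un := fun n x ω => ∑ j, l n x j * X (s j) ω)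
      hX.continuous_covKernel_diag hX.continuous hX.measurable hun (fun n ω => by fun_prop)
      (fun n x => by fun_prop)
      (fun n x => by
        have hcov : covKernel X P x x = ∫ ω, X x ω ^ 2 ∂P := by simp only [covKernel, sq]
        rw [hcov]
        exact lintegral_enorm_exp_sub_exp_le_two
          (hX.gaussian.hasGaussianLaw_sum_mul (fun j : Fin n => s j) (l n x))
          (hX.gaussian.hasGaussianLaw_eval x) (hX.gaussian.integral_sum_mul hX.centered _ _)
          (hX.centered x) β)
      (fun x => tendsto_lintegral_enorm_exp_sub_exp hX.gaussian hX.centered x s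
        (fun n => l n x) (hlim x) β)
  refine lintegral_fieldRatio_le_of_tendsto hlam hnu hX.continuous_covKernel_diag hX.continuous
    hX.measurable hun (fun n ω => by fun_prop) (fun n x => by fun_prop) (hmass α lam) (hmass γ nu)
    hFc fun n => ?_
  exact (lintegral_fieldRatio_sum_mul_le hα h hlam hnu hX hY
    (hXY.submatrix fun j : Fin n => s j) (fun _ _ => rfl) (hlc n) hFm hFc hF0).trans
    (hY.lintegral_fieldRatio_projection_le hα h hlam hnu (hlc n) (hlo n) hFm hFc hF0)

end Main

/-! ### Reduction to regular fields and non-negative functions. -/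

/-- A continuous Gaussian field can be replaced by a regular one without changing its covariance
and, almost surely, its balanced ratio. -/
lemma IsContinuousGaussianField.exists_regular_balancedRatio {T Ω : Type*} [MetricSpace T]
    [CompactSpace T] [MeasurableSpace T] [MeasurableSpace Ω] {X : T → Ω → ℝ} {P : Measure Ω}
    (hX : IsContinuousGaussianField X P) (α γ : ℝ) (lam nu : Measure T) :
    ∃ X' : T → Ω → ℝ, IsRegularGaussianField X' P ∧ covKernel X' P = covKernel X P ∧
      ∀ᵐ ω ∂P, balancedRatio α γ lam nu X P ω =
        fieldRatio α γ lam nu (fun x => covKernel X' P x x) fun x => X' x ω := by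
  obtain ⟨X', hX', hae⟩ := hX.exists_regular
  have hcov : covKernel X' P = covKernel X P := by
    funext x y
    refine integral_congr_ae ?_
    filter_upwards [hae] with ω h
    rw [h x, h y]
  refine ⟨X', hX', hcov, ?_⟩
  filter_upwards [hae] with ω h
  simp only [balancedRatio, chaosMass, fieldRatio, fieldMass, hcov, h]

/-- Shifting by a lower bound turns the extended expectation into a `lintegral` of a non-negative
function minus a finite constant, from `f⁺ + k = (f + k) + f⁻`. -/
lemma extExpectation_eq_sub {Ω : Type*} [MeasurableSpace Ω] {P : Measure Ω} [IsProbabilityMeasure P]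
    {f : Ω → ℝ} {k : ℝ} (hk : 0 ≤ k) (hf : AEMeasurable f P) (hfk : ∀ᵐ ω ∂P, -k ≤ f ω) :
    ∫⁻ ω, ENNReal.ofReal (-f ω) ∂P < ∞ ∧
      extExpectation P f = ((∫⁻ ω, ENNReal.ofReal (f ω + k) ∂P : ℝ≥0∞) : EReal) - (k : EReal) := by
  have hlt : ∫⁻ ω, ENNReal.ofReal (-f ω) ∂P < ∞ := by
    refine lt_of_le_of_lt (lintegral_mono_ae (g := fun _ => ENNReal.ofReal k) ?_) (by simp)
    filter_upwards [hfk] with ω h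
    exact ENNReal.ofReal_le_ofReal (by linarith)
  refine ⟨hlt, ?_⟩
  have hsum : ∫⁻ ω, ENNReal.ofReal (f ω) ∂P + ENNReal.ofReal k =
      ∫⁻ ω, ENNReal.ofReal (f ω + k) ∂P + ∫⁻ ω, ENNReal.ofReal (-f ω) ∂P := by
    have hconst : ENNReal.ofReal k = ∫⁻ _, ENNReal.ofReal k ∂P := by simp
    rw [hconst, ← lintegral_add_left' hf.ennreal_ofReal, ←
      lintegral_add_right' (g := fun ω => ENNReal.ofReal (-f ω)) _ hf.neg.ennreal_ofReal]
    refine lintegral_congr_ae ?_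
    filter_upwards [hfk] with ω h
    rcases le_total 0 (f ω) with h0 | h0
    · rw [ENNReal.ofReal_of_nonpos (neg_nonpos.2 h0), add_zero, ENNReal.ofReal_add h0 hk]
    · rw [ENNReal.ofReal_of_nonpos h0, zero_add,
        ← ENNReal.ofReal_add (by linarith) (by linarith)]
      ring_nf
  rw [extExpectation]
  generalize ∫⁻ ω, ENNReal.ofReal (-f ω) ∂P = N at *
  generalize ∫⁻ ω, ENNReal.ofReal (f ω) ∂P = A at *
  generalize ∫⁻ ω, ENNReal.ofReal (f ω + k) ∂P = B at *
  lift N to NNReal using hlt.ne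
  lift k to NNReal using hk
  rw [ENNReal.ofReal_coe_nnreal] at hsum
  induction A with
  | top =>
    have hB : B = ∞ := by
      rw [top_add] at hsum
      exact (ENNReal.add_eq_top.1 hsum.symm).resolve_right ENNReal.coe_ne_top
    subst hB
    simp only [EReal.coe_ennreal_top, EReal.coe_nnreal_eq_coe_real]
    rw [EReal.top_sub_coe, EReal.top_sub_coe]
  | coe A =>
    have hB : B ≠ ∞ := by
      rintro rfl
      rw [top_add] at hsum
      exact absurd hsum (by rw [← ENNReal.coe_add]; exact ENNReal.coe_ne_top)
    lift B to NNReal using hB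
    have hs : (A : ℝ) + k = B + N := by exact_mod_cast hsum
    simp only [EReal.coe_nnreal_eq_coe_real]
    rw [← EReal.coe_sub, ← EReal.coe_sub]
    congr 1
    linarith

theorem propositionA3 {d : ℕ} (K : Set (EuclideanSpace ℝ (Fin d))) (hK : IsCompact K)
    (α γ : ℝ) (hα : 0 < α) (hγ : 0 < γ) (hαγ : α ≠ γ)
    (lam nu : Measure K) [IsFiniteMeasure lam] [IsFiniteMeasure nu]
    (hlam : lam ≠ 0) (hnu : nu ≠ 0)
    {Ω Ω' : Type*} [MeasurableSpace Ω] [MeasurableSpace Ω']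
    (P : Measure Ω) [IsProbabilityMeasure P] (P' : Measure Ω') [IsProbabilityMeasure P']
    (X : K → Ω → ℝ) (Y : K → Ω' → ℝ)
    (hX : IsContinuousGaussianField X P) (hY : IsContinuousGaussianField Y P')
    (hXY : (Matrix.of fun x y : K => covKernel Y P' x y - covKernel X P x y).PosSemidef)
    (F : ℝ → ℝ) (hFmono : MonotoneOn F (Set.Ioi 0)) (hFconv : ConvexOn ℝ (Set.Ioi 0) F) :
    (∀ᵐ ω ∂P, 0 < balancedRatio α γ lam nu X P ω) ∧
    (∀ᵐ ω ∂P', 0 < balancedRatio α γ lam nu Y P' ω) ∧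
    HasExpectation P (fun ω => F (balancedRatio α γ lam nu X P ω)) ∧
    HasExpectation P' (fun ω => F (balancedRatio α γ lam nu Y P' ω)) ∧
    extExpectation P (fun ω => F (balancedRatio α γ lam nu X P ω)) ≤
      extExpectation P' (fun ω => F (balancedRatio α γ lam nu Y P' ω)) := by
  have : CompactSpace K := isCompact_iff_compactSpace.1 hK
  obtain ⟨X', hX', hcX, heX⟩ := hX.exists_regular_balancedRatio α γ lam nu
  obtain ⟨Y', hY', hcY, heY⟩ := hY.exists_regular_balancedRatio α γ lam nu
  rw [← hcX, ← hcY] at hXY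
  have hXpos : ∀ᵐ ω ∂P, 0 < balancedRatio α γ lam nu X P ω := by
    filter_upwards [heX] with ω h
    rw [h]
    exact fieldRatio_pos α γ hlam hnu hX'.continuous_covKernel_diag (hX'.continuous ω)
  have hYpos : ∀ᵐ ω ∂P', 0 < balancedRatio α γ lam nu Y P' ω := by
    filter_upwards [heY] with ω h
    rw [h]
    exact fieldRatio_pos α γ hlam hnu hY'.continuous_covKernel_diag (hY'.continuous ω)
  have hXm : AEMeasurable (fun ω => F (balancedRatio α γ lam nu X P ω)) P :=
    ⟨_, measurable_comp_fieldRatio hlam hnu hX'.continuous_covKernel_diag hX'.continuous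
      hX'.measurable hFconv, by filter_upwards [heX] with ω h using congrArg F h⟩
  have hYm : AEMeasurable (fun ω => F (balancedRatio α γ lam nu Y P' ω)) P' :=
    ⟨_, measurable_comp_fieldRatio hlam hnu hY'.continuous_covKernel_diag hY'.continuous
      hY'.measurable hFconv, by filter_upwards [heY] with ω h using congrArg F h⟩
  obtain ⟨k, hk, hFk⟩ : ∃ k : ℝ, 0 ≤ k ∧ ∀ x, 0 < x → -k ≤ F x := by
    -- The supporting line at `1` has non-negative slope `D`, so on `(0, ∞)` it stays above its
    -- value `F 1 - D` at `0`.
    refine ⟨max 0 (derivWithin F (Set.Ioi 1) 1 - F 1), le_max_left _ _, fun x hx => ?_⟩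
    have h1 := hFconv.add_rightDeriv_mul_sub_le one_pos hx
    have h2 := mul_nonneg (hFmono.rightDeriv_nonneg one_pos) hx.le
    have h3 := le_max_right 0 (derivWithin F (Set.Ioi 1) 1 - F 1)
    linarith
  obtain ⟨hXfin, hXe⟩ := extExpectation_eq_sub hk hXm (hXpos.mono fun ω h => hFk _ h)
  obtain ⟨hYfin, hYe⟩ := extExpectation_eq_sub hk hYm (hYpos.mono fun ω h => hFk _ h)
  refine ⟨hXpos, hYpos, ⟨hXm, hXfin⟩, ⟨hYm, hYfin⟩, ?_⟩
  rw [hXe, hYe]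
  refine EReal.sub_le_sub (EReal.coe_ennreal_le_coe_ennreal_iff.2 ?_) le_rfl
  have hmain := hX'.lintegral_fieldRatio_le hα hγ hαγ hlam hnu hY' hXY (F := fun x => F x + k)
    (fun x hx y hy hxy => by simpa using hFmono hx hy hxy) (hFconv.add_const k)
    fun x hx => by linarith [hFk x hx]
  calc
    _ = _ := lintegral_congr_ae (by filter_upwards [heX] with ω h; rw [h])
    _ ≤ _ := hmain
    _ = _ := lintegral_congr_ae (by filter_upwards [heY] with ω h; rw [h])
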